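/- **Setting.** $N\ge 1$ agents have action sets $\mathcal X_i\subset\mathbb R^d$ ($d\ge1$), closed and convex, containing the ball of radius $R>0$ centred at the origin and of diameter at most $D>0$; $\mathcal X=\prod_i\mathcal X_i$. Agent $i$ has a (measurable) cost $C_i(x_i,x_{-i})$, which is $\mu_i$-strongly convex and differentiable in $x_i\in\mathcal X_i$ for every $x_{-i}$; its partial gradient $\nabla_iC_i$ is $L_{ij}$-Lipschitz in $x_j$ on $\mathcal X$ for all $i,j$, and there are $r_i>0$ with $r_i\mu_i>\sum_{j\ne i}r_jL_{ij}$ for all $i$. Moreover $\|\nabla_iC_i(x)\|\le U$ and $|C_i(x)|\le U_c$ for all $x\in\mathcal X$. Let $\varepsilon=\min_i\big(\mu_i-\frac1{r_i}\sum_{j\ne i}r_jL_{ij}\big)>0$. **Algorithm.** Each agent $i$ has a set $\mathbb T^i$ of update times such that, for an integer $B\ge1$, every interval $[t,t+B)$, $t\ge 1$, contains an element of $\mathbb T^i$. Fix $\delta\in(0,R)$, $\eta>0$, and let $\mathcal X_i^\delta=\{x\in\mathcal X_i:\frac1{1-\delta/R}x\in\mathcal X_i\}$. Start from $x_{i,1}\in\mathcal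 X_i^\delta$ and $\hat x_{i,0}\in\mathcal X_i$. At each time $t=1,\dots,T$: if $t\in\mathbb T^i$, agent $i$ samples $u_{i,t}$ uniformly from the unit sphere of $\mathbb R^d$ (all samples independent) and plays $\hat x_{i,t}=x_{i,t}+\delta u_{i,t}$; otherwise it plays $\hat x_{i,t}=\hat x_{i,t-1}$. Then, if $t\in\mathbb T^i$, $x_{i,t+1}=\mathcal P_{\mathcal X_i^\delta}(x_{i,t}-\eta g_{i,t})$ with $g_{i,t}=\frac d\delta C_i(\hat x_t)u_{i,t}$, where $\mathcal P$ is the Euclidean projection; otherwise $x_{i,t+1}=x_{i,t}$. **Theorem.** The game has a unique Nash equilibrium $x^*$. Choose $\delta=B/T^{1/3}$ and $\eta=\frac{B\ln(T/B)}{\varepsilon T}$. Then $$\max_i\mathbb E\|x_{i,T}-x_i^*\|^2=O\!\left(\frac{B^2\ln(T/B)}{T^{1/3}}\right),$$ that is: there is a constant $K$ depending only on $N,d,R,D,U,U_c,(\mu_i),(r_i),(L_{ij})$ such that, for every such game, all integers $1\le B<T$ with $B/T^{1/3}<R$, all update schedules as above and all initial values as above, $\max_i\mathbb E\|x_{i,T}-x_i^*\|^2\le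 K\,B^2\ln(T/B)/T^{1/3}$. -/

import Mathlib

open MeasureTheory ProbabilityTheory

noncomputable section

/-- The action space `ℝ^d` of one agent, with the Euclidean norm. -/
abbrev Act (d : ℕ) : Type := EuclideanSpace ℝ (Fin d)

/-- Joint actions of `N` agents. -/
abbrev JointAct (N d : ℕ) : Type := Fin N → Act d

/-- The joint action set `∏ i, X i`. -/
def jointSet {N d : ℕ} (X : Fin N → Set (Act d)) : Set (JointAct N d) :=
  {x | ∀ i, x i ∈ X i}

/-- The partial gradient `∇_i C_i(x)`: the gradient in the `i`-th block, taken within `X i`.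
When `X i` is convex with nonempty interior, it is uniquely determined at every point of `X i`,
and it is the usual gradient at interior points. -/
def partialGrad {N d : ℕ} (X : Fin N → Set (Act d)) (C : Fin N → JointAct N d → ℝ)
    (i : Fin N) (x : JointAct N d) : Act d :=
  gradientWithin (fun y : Act d => C i (Function.update x i y)) (X i) (x i)

/-- `x` is a Nash equilibrium: no agent can lower its own cost by a unilateral deviation. -/
def IsNash {N d : ℕ} (X : Fin N → Set (Act d)) (C : Fin N → JointAct N d → ℝ)
    (x : JointAct N d) : Prop :=
  x ∈ jointSet X ∧ ∀ i, ∀ y ∈ X i, C i x ≤ C i (Function.update x i y)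

/-- The standing assumptions on the game. Costs are only constrained on the joint action set. -/
structure IsQuasidominantGame {N d : ℕ} (R D U Uc : ℝ) (μ r : Fin N → ℝ) (L : Fin N → Fin N → ℝ)
    (X : Fin N → Set (Act d)) (C : Fin N → JointAct N d → ℝ) : Prop where
  R_pos : 0 < R
  D_pos : 0 < D
  closed : ∀ i, IsClosed (X i)
  convex : ∀ i, Convex ℝ (X i)
  ball_subset : ∀ i, Metric.closedBall (0 : Act d) R ⊆ X i
  diam_le : ∀ i, ∀ x ∈ X i, ∀ y ∈ X i, ‖x - y‖ ≤ D
  /-- measurability of the costs on the joint action set -/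
  measurable_cost : ∀ i, Measurable (fun x : jointSet X => C i x)
  /-- `C_i` is `μ_i`-strongly convex in `x_i` for every `x_{-i}` -/
  strongConvex : ∀ i, ∀ x ∈ jointSet X,
    StrongConvexOn (X i) (μ i) (fun y => C i (Function.update x i y))
  /-- `C_i` is differentiable in `x_i` -/
  differentiable : ∀ i, ∀ x ∈ jointSet X,
    DifferentiableWithinAt ℝ (fun y => C i (Function.update x i y)) (X i) (x i)
  L_nonneg : ∀ i j, 0 ≤ L i j
  /-- `∇_i C_i` is `L_ij`-Lipschitz in `x_j` -/
  lipschitz : ∀ i j, ∀ x ∈ jointSet X, ∀ y ∈ X j,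
    ‖partialGrad X C i (Function.update x j y) - partialGrad X C i x‖ ≤ L i j * ‖y - x j‖
  r_pos : ∀ i, 0 < r i
  quasidominance : ∀ i, ∑ j ∈ Finset.univ.erase i, r j * L i j < r i * μ i
  grad_bound : ∀ i, ∀ x ∈ jointSet X, ‖partialGrad X C i x‖ ≤ U
  cost_bound : ∀ i, ∀ x ∈ jointSet X, |C i x| ≤ Uc

/-- `ε = min_i (μ_i - (1/r_i) ∑_{j ≠ i} r_j L_ij)` (an infimum over finitely many agents). -/
def quasidominanceGap {N : ℕ} (μ r : Fin N → ℝ) (L : Fin N → Fin N → ℝ) : ℝ :=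
  ⨅ i : Fin N, (μ i - 1 / r i * ∑ j ∈ Finset.univ.erase i, r j * L i j)

/-- Partial asynchronism: `S i` is the set of time steps at which agent `i` is scheduled to update,
and each agent is scheduled at least once in every interval `[t, t + B)`, `t ≥ 1`. -/
def PartiallyAsynchronous {N : ℕ} (S : Fin N → Set ℕ) (B : ℕ) : Prop :=
  ∀ i, ∀ t : ℕ, 1 ≤ t → ∃ s ∈ S i, t ≤ s ∧ s < t + B

open Classical in
/-- The metric projection onto `K`: a point of `K` nearest to `z` (it exists and is unique
when `K` is nonempty, closed and convex). -/
def projOnto {d : ℕ} (K : Set (Act d)) (z : Act d) : Act d :=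
  if h : ∃ p ∈ K, ∀ q ∈ K, ‖z - p‖ ≤ ‖z - q‖ then h.choose else z

/-- The shrunk set `X^δ = {x ∈ X | (1 / (1 - δ/R)) x ∈ X}`. -/
def shrunk {d : ℕ} (R δ : ℝ) (X : Set (Act d)) : Set (Act d) :=
  {x | x ∈ X ∧ (1 / (1 - δ / R)) • x ∈ X}

/-- The uniform probability measure on the unit sphere of `ℝ^d`: normalized surface measure. -/
def uniformSphere (d : ℕ) : Measure (Metric.sphere (0 : Act d) 1) :=
  ((volume : Measure (Act d)).toSphere Set.univ)⁻¹ • (volume : Measure (Act d)).toSphere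

open Classical in
/-- The played joint action at time `t`, given the current iterate `x`, the previously played
action `xhat` and the sampled directions `u`: active agents play `x_i + δ u_i`, the others repeat
their previous action. -/
def zoPlay {N d : ℕ} (δ : ℝ) (S : Fin N → Set ℕ) (t : ℕ)
    (u : Fin N → Metric.sphere (0 : Act d) 1) (x xhat : JointAct N d) : JointAct N d :=
  fun i => if t ∈ S i then x i + δ • (u i : Act d) else xhat i

open Classical in
/-- The next iterate, given the current iterate `x` and the played joint action `xhat`: an active
agent moves along the one-point estimate `g_i = (d/δ) C_i(xhat) u_i` and projects onto `X_i^δ`. -/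
def zoUpdate {N d : ℕ} (R δ η : ℝ) (X : Fin N → Set (Act d)) (C : Fin N → JointAct N d → ℝ)
    (S : Fin N → Set ℕ) (t : ℕ)
    (u : Fin N → Metric.sphere (0 : Act d) 1) (x xhat : JointAct N d) : JointAct N d :=
  fun i => if t ∈ S i then
    projOnto (shrunk R δ (X i)) (x i - η • (((d : ℝ) / δ * C i xhat) • (u i : Act d)))
  else x i

/-- The pair `(x_{k+1}, xhat_k)` generated by the zeroth-order asynchronous algorithm from the
initial values `x_1` and `xhat_0`, with sampled directions `u i t`. -/
def zoState {N d : ℕ} (R δ η : ℝ) (X : Fin N → Set (Act d)) (C : Fin N → JointAct N d → ℝ)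
    (S : Fin N → Set ℕ) (x₁ xhat₀ : JointAct N d)
    (u : Fin N → ℕ → Metric.sphere (0 : Act d) 1) : ℕ → JointAct N d × JointAct N d
  | 0 => (x₁, xhat₀)
  | k + 1 =>
    let s := zoState R δ η X C S x₁ xhat₀ u k
    let xhat := zoPlay δ S (k + 1) (fun i => u i (k + 1)) s.1 s.2
    (zoUpdate R δ η X C S (k + 1) (fun i => u i (k + 1)) s.1 xhat, xhat)

/-- The iterate `x_t`, for `t ≥ 1`. -/
def zoIterate {N d : ℕ} (R δ η : ℝ) (X : Fin N → Set (Act d)) (C : Fin N → JointAct N d → ℝ)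
    (S : Fin N → Set ℕ) (x₁ xhat₀ : JointAct N d)
    (u : Fin N → ℕ → Metric.sphere (0 : Act d) 1) (t : ℕ) : JointAct N d :=
  (zoState R δ η X C S x₁ xhat₀ u (t - 1)).1

/-- The pairs (agent, time) at which a direction is sampled within the horizon `T`. -/
abbrev ActivePair {N : ℕ} (S : Fin N → Set ℕ) (T : ℕ) : Type :=
  {p : Fin N × ℕ // p.2 ∈ S p.1 ∧ 1 ≤ p.2 ∧ p.2 ≤ T}

/-- The directions sampled by the algorithm (agent `i` at an active time `t`) are independent and
uniformly distributed on the unit sphere. -/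
structure IsUniformSampling {N d : ℕ} {Ω : Type*} [MeasurableSpace Ω] (P : Measure Ω)
    (S : Fin N → Set ℕ) (T : ℕ) (u : Fin N → ℕ → Ω → Metric.sphere (0 : Act d) 1) : Prop where
  measurable : ∀ p : ActivePair S T, Measurable (u p.1.1 p.1.2)
  law : ∀ p : ActivePair S T, P.map (u p.1.1 p.1.2) = uniformSphere d
  indep : iIndepFun (fun p : ActivePair S T => u p.1.1 p.1.2) P

end

/-! Strong convexity gives each agent a restoring force of strength `μ i`, while the Lipschitz
constants bound the influence of the other agents. Quasidominance is therefore a diagonal dominance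
for the norm `max_i ‖x i‖ / r i`. In this norm the best-response map strictly decreases distances,
so on the compact joint action set a point of least displacement is a fixed point, and there is only
one (`existsUnique_isNash`).

For the rate, the tracked quantity is the mean square distance `V i` of the iterate to the shrunk
equilibrium `(1 - δ/R) x*`, which lies in the set onto which the algorithm projects. Averaging the
one-point estimate over the agent's own fresh direction, all else fixed, gives the partial gradient
at the others' plays up to a bias of order `δ`, because the uniform law on the sphere has mean zero
and covariance `I / d` (`inner_le_integral_onePoint`). The others' plays are outdated, but an idle
agent moves neither its play nor its iterate: once it has acted, the two differ by at most `δ` plus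
one step, whatever the delay (`norm_zoState_snd_sub_fst_le`). A weighted AM-GM inequality then shows
that if all `V j / r j ^ 2` are at most `c + A`, an update brings that of the active agent below `c
+ (1 - 2ηε) A`, where `c` is of order `δ + η / δ ^ 2` (`integral_step_le`, `weighted_step_le`).

Each window of length `B` contains an update of every agent, so it multiplies the excess `A` by `1 -
2ηε` (`window_contraction`). The logarithm in `η` makes about `T / B` windows reduce the excess to
order `(B / T) ^ 2`, and the chosen `δ` keeps `δ` and `η / δ ^ 2` within the rate. If `η` is too
large for the contraction, `T / B` is bounded by constants of the game and the diameter bound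
suffices. -/

open scoped RealInnerProductSpace in
/-- First-order lower bound for a strongly convex function. -/
theorem StrongConvexOn.le_sub_of_hasGradientWithinAt {E : Type*} [NormedAddCommGroup E]
    [InnerProductSpace ℝ E] [CompleteSpace E] {s : Set E} {m : ℝ} {f : E → ℝ} {g x y : E}
    (hf : StrongConvexOn s m f) (hg : HasGradientWithinAt f g s x) (hx : x ∈ s) (hy : y ∈ s) :
    ⟪g, y - x⟫ + m / 2 * ‖y - x‖ ^ 2 ≤ f y - f x := by
  have hmaps : Set.MapsTo (fun t : ℝ => x + t • (y - x)) (Set.Icc 0 1) s := by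
    intro t ht
    exact hf.1.add_smul_sub_mem hx hy ht
  have hline : HasDerivWithinAt (fun t : ℝ => x + t • (y - x)) (y - x) (Set.Icc 0 1) 0 := by
    have h : HasDerivAt (fun t : ℝ => x + t • (y - x)) ((1 : ℝ) • (y - x)) 0 :=
      ((hasDerivAt_id (0 : ℝ)).smul_const (y - x)).const_add x
    rw [one_smul] at h
    exact h.hasDerivWithinAt
  have hd : HasDerivWithinAt (fun t : ℝ => f (x + t • (y - x))) ⟪g, y - x⟫ (Set.Icc 0 1) 0 := by
    have hg' := hg.hasFDerivWithinAt
    have := HasFDerivWithinAt.comp_hasDerivWithinAt_of_eq (0 : ℝ) hg' hline hmaps (by simp)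
    simpa [Function.comp_def] using this
  have hlim := hasDerivWithinAt_iff_tendsto_slope.1 hd
  have hne : (nhdsWithin (0 : ℝ) (Set.Icc 0 1 \ {0})).NeBot := by
    have : Set.Icc (0 : ℝ) 1 \ {0} = Set.Ioc 0 1 := by
      ext t; simp only [Set.mem_sdiff, Set.mem_Icc, Set.mem_singleton_iff, Set.mem_Ioc]
      constructor
      · rintro ⟨⟨h0, h1⟩, h2⟩; exact ⟨lt_of_le_of_ne h0 (Ne.symm h2), h1⟩
      · rintro ⟨h0, h1⟩; exact ⟨⟨h0.le, h1⟩, h0.ne'⟩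
    rw [this]
    exact left_nhdsWithin_Ioc_neBot one_pos
  have hlim2 : Filter.Tendsto (fun t : ℝ => f y - f x - (1 - t) * (m / 2 * ‖y - x‖ ^ 2))
      (nhdsWithin (0 : ℝ) (Set.Icc 0 1 \ {0})) (nhds (f y - f x - (1 - 0) * (m / 2 * ‖y - x‖ ^ 2))) := by
    apply Filter.Tendsto.mono_left _ nhdsWithin_le_nhds
    exact Continuous.tendsto (by fun_prop) 0
  -- Strong convexity at `x + t • (y - x)`, divided by `t`, bounds the slope at `0` by a quantity
  -- that keeps the factor `1 - t` on the quadratic term. That factor tends to `1`.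
  have key := le_of_tendsto_of_tendsto hlim hlim2 (by
    filter_upwards [self_mem_nhdsWithin] with t ht
    obtain ⟨⟨h0, h1⟩, h2⟩ := ht
    have h0' : 0 < t := lt_of_le_of_ne h0 (Ne.symm h2)
    have hc := hf.2 hx hy (sub_nonneg.2 h1) h0 (by ring)
    have he : (1 - t) • x + t • y = x + t • (y - x) := by module
    rw [he, norm_sub_rev] at hc
    simp only [smul_eq_mul] at hc
    rw [slope_def_field, sub_zero, zero_smul, add_zero, div_le_iff₀ h0']
    nlinarith)
  linarith

/-! ### Geometry of the game and the unique Nash equilibrium -/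

section Game

open scoped RealInnerProductSpace

variable {N d : ℕ} {R D U Uc : ℝ} {μ r : Fin N → ℝ} {L : Fin N → Fin N → ℝ}
  {X : Fin N → Set (Act d)} {C : Fin N → JointAct N d → ℝ}

theorem jointSet_update {x : JointAct N d} (hx : x ∈ jointSet X) {i : Fin N} {y : Act d}
    (hy : y ∈ X i) : Function.update x i y ∈ jointSet X := by
  intro j
  by_cases h : j = i
  · subst h; simpa using hy
  · simpa [h] using hx j

theorem partialGrad_update (i : Fin N) (x : JointAct N d) (y : Act d) :
    partialGrad X C i (Function.update x i y) =
      gradientWithin (fun z : Act d => C i (Function.update x i z)) (X i) y := by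
  simp [partialGrad]

namespace IsQuasidominantGame

theorem hasGradientWithinAt (h : IsQuasidominantGame R D U Uc μ r L X C) (i : Fin N)
    {x : JointAct N d} (hx : x ∈ jointSet X) {y : Act d} (hy : y ∈ X i) :
    HasGradientWithinAt (fun z : Act d => C i (Function.update x i z))
      (partialGrad X C i (Function.update x i y)) (X i) y := by
  rw [partialGrad_update]
  have := h.differentiable i _ (jointSet_update hx hy)
  simp only [Function.update_idem, Function.update_self] at this
  exact this.hasGradientWithinAt

theorem inner_partialGrad_add_le (h : IsQuasidominantGame R D U Uc μ r L X C) (i : Fin N)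
    {x : JointAct N d} (hx : x ∈ jointSet X) {y z : Act d} (hy : y ∈ X i) (hz : z ∈ X i) :
    ⟪partialGrad X C i (Function.update x i y), z - y⟫ + μ i / 2 * ‖z - y‖ ^ 2 ≤
      C i (Function.update x i z) - C i (Function.update x i y) :=
  (h.strongConvex i x hx).le_sub_of_hasGradientWithinAt (h.hasGradientWithinAt i hx hy) hy hz

/-- The partial gradient is strongly monotone in the agent's own action. -/
theorem strongMonotone (h : IsQuasidominantGame R D U Uc μ r L X C) (i : Fin N)
    {x : JointAct N d} (hx : x ∈ jointSet X) {y z : Act d} (hy : y ∈ X i) (hz : z ∈ X i) :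
    μ i * ‖z - y‖ ^ 2 ≤ ⟪partialGrad X C i (Function.update x i z) -
      partialGrad X C i (Function.update x i y), z - y⟫ := by
  have h1 := h.inner_partialGrad_add_le i hx hy hz
  have h2 := h.inner_partialGrad_add_le i hx hz hy
  rw [norm_sub_rev, ← neg_sub z y, inner_neg_right] at h2
  rw [inner_sub_left]
  linarith

/-- The blocks are changed one at a time. Membership is carried through the induction because the
Lipschitz bounds hold only on the joint action set. -/
theorem norm_partialGrad_piecewise_sub_le (h : IsQuasidominantGame R D U Uc μ r L X C) (i : Fin N)
    {x y : JointAct N d} (hx : x ∈ jointSet X) (hy : y ∈ jointSet X) (s : Finset (Fin N)) :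
    s.piecewise y x ∈ jointSet X ∧ ‖partialGrad X C i (s.piecewise y x) - partialGrad X C i x‖ ≤
      ∑ j ∈ s, L i j * ‖y j - x j‖ := by
  classical
  induction s using Finset.induction_on with
  | empty => simpa using hx
  | insert j s hj ih =>
    rw [Finset.piecewise_insert, Finset.sum_insert hj]
    refine ⟨jointSet_update ih.1 (hy j), ?_⟩
    have h1 := h.lipschitz i j _ ih.1 (y j) (hy j)
    rw [Finset.piecewise_eq_of_notMem _ _ _ hj] at h1
    calc _ ≤ _ := norm_sub_le_norm_sub_add_norm_sub _ (partialGrad X C i (s.piecewise y x)) _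
      _ ≤ _ := add_le_add h1 ih.2

theorem norm_partialGrad_sub_le (h : IsQuasidominantGame R D U Uc μ r L X C) (i : Fin N)
    {x y : JointAct N d} (hx : x ∈ jointSet X) (hy : y ∈ jointSet X) :
    ‖partialGrad X C i y - partialGrad X C i x‖ ≤ ∑ j, L i j * ‖y j - x j‖ := by
  classical
  simpa using (h.norm_partialGrad_piecewise_sub_le i hx hy Finset.univ).2

theorem norm_partialGrad_sub_le_of_eq (h : IsQuasidominantGame R D U Uc μ r L X C) (i : Fin N)
    {x y : JointAct N d} (hx : x ∈ jointSet X) (hy : y ∈ jointSet X) (hxy : y i = x i) :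
    ‖partialGrad X C i y - partialGrad X C i x‖ ≤
      ∑ j ∈ Finset.univ.erase i, L i j * ‖y j - x j‖ := by
  refine (h.norm_partialGrad_sub_le i hx hy).trans_eq ?_
  rw [← Finset.add_sum_erase _ _ (Finset.mem_univ i), hxy]
  simp

theorem mu_pos (h : IsQuasidominantGame R D U Uc μ r L X C) (i : Fin N) : 0 < μ i := by
  have h1 := h.quasidominance i
  have h2 : 0 ≤ ∑ j ∈ Finset.univ.erase i, r j * L i j :=
    Finset.sum_nonneg fun j _ => mul_nonneg (h.r_pos j).le (h.L_nonneg i j)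
  exact pos_of_mul_pos_right (h2.trans_lt h1) (h.r_pos i).le

theorem zero_mem (h : IsQuasidominantGame R D U Uc μ r L X C) (i : Fin N) : (0 : Act d) ∈ X i :=
  h.ball_subset i (by simp [h.R_pos.le])

theorem norm_le (h : IsQuasidominantGame R D U Uc μ r L X C) {i : Fin N} {x : Act d}
    (hx : x ∈ X i) : ‖x‖ ≤ D := by
  simpa using h.diam_le i x hx 0 (h.zero_mem i)

theorem isCompact (h : IsQuasidominantGame R D U Uc μ r L X C) (i : Fin N) : IsCompact (X i) :=
  Metric.isCompact_of_isClosed_isBounded (h.closed i)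
    (Metric.isBounded_iff.2 ⟨D, fun x hx y hy => by
      rw [dist_eq_norm]; exact h.diam_le i x hx y hy⟩)

theorem exists_bestResponse (h : IsQuasidominantGame R D U Uc μ r L X C) (i : Fin N)
    {x : JointAct N d} (hx : x ∈ jointSet X) : ∃ p ∈ X i, ∀ q ∈ X i,
      C i (Function.update x i p) ≤ C i (Function.update x i q) := by
  obtain ⟨p, hp, hmin⟩ := (h.isCompact i).exists_isMinOn ⟨0, h.zero_mem i⟩
    (f := fun y => C i (Function.update x i y)) (fun y hy =>
      (h.hasGradientWithinAt i hx hy).differentiableWithinAt.continuousWithinAt)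
  exact ⟨p, hp, fun q hq => hmin hq⟩

/-- First-order optimality of a best response. -/
theorem inner_partialGrad_nonneg (h : IsQuasidominantGame R D U Uc μ r L X C) (i : Fin N)
    {x : JointAct N d} (hx : x ∈ jointSet X) {p q : Act d} (hp : p ∈ X i) (hq : q ∈ X i)
    (hmin : ∀ q ∈ X i, C i (Function.update x i p) ≤ C i (Function.update x i q)) :
    0 ≤ ⟪partialGrad X C i (Function.update x i p), q - p⟫ := by
  have hd := (h.hasGradientWithinAt i hx hp).hasFDerivWithinAt
  have hloc : IsLocalMinOn (fun y => C i (Function.update x i y)) (X i) p :=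
    IsMinOn.localize (fun q hq => hmin q hq)
  have := hloc.hasFDerivWithinAt_nonneg hd
    (sub_mem_posTangentConeAt_of_segment_subset ((h.convex i).segment_subset hp hq))
  simpa using this

/-- Best responses depend on the other agents' actions in a Lipschitz way. -/
theorem norm_bestResponse_sub_le (h : IsQuasidominantGame R D U Uc μ r L X C) (i : Fin N)
    {x y : JointAct N d} (hx : x ∈ jointSet X) (hy : y ∈ jointSet X) {p q : Act d}
    (hp : p ∈ X i) (hq : q ∈ X i)
    (hpmin : ∀ z ∈ X i, C i (Function.update x i p) ≤ C i (Function.update x i z))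
    (hqmin : ∀ z ∈ X i, C i (Function.update y i q) ≤ C i (Function.update y i z)) :
    μ i * ‖p - q‖ ≤ ∑ j ∈ Finset.univ.erase i, L i j * ‖x j - y j‖ := by
  -- The two optimality conditions, inserted into strong monotonicity with the others at `x`, leave
  -- only the change of the gradient at own action `q` when the others move from `x` to `y`. One
  -- factor `‖p - q‖` then cancels.
  have h1 := h.inner_partialGrad_nonneg i hx hp hq hpmin
  have h2 := h.inner_partialGrad_nonneg i hy hq hp hqmin
  have h3 := h.strongMonotone i hx hq hp
  have h4 := h.norm_partialGrad_sub_le_of_eq i (jointSet_update hx hq) (jointSet_update hy hq)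
    (by simp)
  have h5 : ∑ j ∈ Finset.univ.erase i,
      L i j * ‖Function.update y i q j - Function.update x i q j‖ =
      ∑ j ∈ Finset.univ.erase i, L i j * ‖x j - y j‖ := by
    refine Finset.sum_congr rfl fun j hj => ?_
    rw [Function.update_of_ne (Finset.ne_of_mem_erase hj),
      Function.update_of_ne (Finset.ne_of_mem_erase hj), norm_sub_rev]
  rw [h5] at h4
  have h6 := real_inner_le_norm (partialGrad X C i (Function.update y i q) -
    partialGrad X C i (Function.update x i q)) (p - q)
  rw [inner_sub_left] at h3 h6
  rw [← neg_sub p q, inner_neg_right] at h1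
  rcases (norm_nonneg (p - q)).eq_or_lt with h0 | h0
  · rw [← h0, mul_zero]
    exact Finset.sum_nonneg fun j _ => mul_nonneg (h.L_nonneg i j) (norm_nonneg _)
  · refine le_of_mul_le_mul_right ?_ h0
    nlinarith [mul_le_mul_of_nonneg_right h4 h0.le]

theorem isCompact_jointSet (h : IsQuasidominantGame R D U Uc μ r L X C) :
    IsCompact (jointSet X) := by
  have := isCompact_univ_pi (fun i => h.isCompact i)
  convert this using 1
  ext x; simp [jointSet]

/-- A weighted maximum-norm contraction estimate. -/
theorem sum_erase_lt (h : IsQuasidominantGame R D U Uc μ r L X C) (i : Fin N) {M : ℝ} (hM : 0 < M)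
    {a : Fin N → ℝ} (ha : ∀ j, a j ≤ r j * M) :
    ∑ j ∈ Finset.univ.erase i, L i j * a j < μ i * (r i * M) := by
  calc ∑ j ∈ Finset.univ.erase i, L i j * a j
      ≤ ∑ j ∈ Finset.univ.erase i, (r j * L i j) * M := by
        refine Finset.sum_le_sum fun j _ => ?_
        calc L i j * a j ≤ L i j * (r j * M) := mul_le_mul_of_nonneg_left (ha j) (h.L_nonneg i j)
          _ = _ := by ring
    _ = (∑ j ∈ Finset.univ.erase i, r j * L i j) * M := by rw [Finset.sum_mul]
    _ < (r i * μ i) * M := mul_lt_mul_of_pos_right (h.quasidominance i) hM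
    _ = _ := by ring

/-- The weighted maximum norm of a joint action. -/
theorem norm_weighted_le_iff (h : IsQuasidominantGame R D U Uc μ r L X C) (x : JointAct N d)
    {M : ℝ} (hM : 0 ≤ M) : ‖fun i => (r i)⁻¹ • x i‖ ≤ M ↔ ∀ i, ‖x i‖ ≤ r i * M := by
  rw [pi_norm_le_iff_of_nonneg hM]
  refine forall_congr' fun i => ?_
  rw [norm_smul, norm_inv, Real.norm_of_nonneg (h.r_pos i).le, inv_mul_le_iff₀ (h.r_pos i)]

/-- Equilibria are mutual best responses, so the contraction estimate makes every weighted component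
of `x - y` strictly smaller than the maximum of them all, unless that maximum is zero. -/
theorem eq_of_isNash (h : IsQuasidominantGame R D U Uc μ r L X C) {x y : JointAct N d}
    (hx : IsNash X C x) (hy : IsNash X C y) : x = y := by
  by_contra hne
  set M := ‖fun i => (r i)⁻¹ • (x - y) i‖ with hMdef
  have hle := (h.norm_weighted_le_iff (x - y) (norm_nonneg _)).1 hMdef.ge
  have hM : 0 < M := by
    rcases (norm_nonneg _ : 0 ≤ M).eq_or_lt with h0 | h0
    · refine absurd (funext fun i => ?_) hne
      have := hle i
      rw [← h0, mul_zero, norm_le_zero_iff] at this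
      exact sub_eq_zero.1 this
    · exact h0
  have hlt : ∀ i, ‖(r i)⁻¹ • (x - y) i‖ < M := by
    intro i
    have h1 := h.norm_bestResponse_sub_le i hx.1 hy.1 (hx.1 i) (hy.1 i)
      (by simpa using hx.2 i) (by simpa using hy.2 i)
    have h2 := h.sum_erase_lt i hM (a := fun j => ‖x j - y j‖) hle
    rw [norm_smul, norm_inv, Real.norm_of_nonneg (h.r_pos i).le, inv_mul_lt_iff₀ (h.r_pos i)]
    exact lt_of_mul_lt_mul_left (h1.trans_lt h2) (h.mu_pos i).le
  exact lt_irrefl M ((pi_norm_lt_iff hM).2 hlt)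

/-- The weighted displacement `‖F x - x‖` of the best-response map `F` attains its minimum by
compactness. Were it positive at `x`, it would be strictly smaller at `F x`. -/
theorem exists_isNash (h : IsQuasidominantGame R D U Uc μ r L X C) : ∃ x, IsNash X C x := by
  classical
  have hbr : ∀ x : JointAct N d, ∃ F : JointAct N d, x ∈ jointSet X → F ∈ jointSet X ∧
      ∀ i, ∀ q ∈ X i, C i (Function.update x i (F i)) ≤ C i (Function.update x i q) := by
    intro x
    by_cases hx : x ∈ jointSet X
    · choose p hp hmin using fun i => h.exists_bestResponse i hx
      exact ⟨p, fun _ => ⟨hp, hmin⟩⟩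
    -- An arbitrary value outside the joint action set makes `F` a total function.
    · exact ⟨x, fun hx' => absurd hx' hx⟩
  choose F hF using hbr
  have hlip : ∀ x ∈ jointSet X, ∀ y ∈ jointSet X, ∀ i, μ i * ‖F x i - F y i‖ ≤
      ∑ j ∈ Finset.univ.erase i, L i j * ‖x j - y j‖ := fun x hx y hy i =>
    h.norm_bestResponse_sub_le i hx hy ((hF x hx).1 i) ((hF y hy).1 i) ((hF x hx).2 i)
      ((hF y hy).2 i)
  have hcont : ContinuousOn F (jointSet X) := by
    refine continuousOn_pi.2 fun i x hx => ?_
    rw [ContinuousWithinAt, tendsto_iff_norm_sub_tendsto_zero]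
    have hb : Filter.Tendsto
        (fun y : JointAct N d => (μ i)⁻¹ * ∑ j ∈ Finset.univ.erase i, L i j * ‖y j - x j‖)
        (nhdsWithin x (jointSet X)) (nhds 0) := by
      have hc : Continuous
          (fun y : JointAct N d => (μ i)⁻¹ * ∑ j ∈ Finset.univ.erase i, L i j * ‖y j - x j‖) := by
        fun_prop
      simpa using (hc.tendsto x).mono_left (nhdsWithin_le_nhds (s := jointSet X))
    refine tendsto_of_tendsto_of_tendsto_of_le_of_le' tendsto_const_nhds hb
      (Filter.Eventually.of_forall fun y => norm_nonneg _) ?_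
    filter_upwards [self_mem_nhdsWithin] with y hy
    rw [← div_eq_inv_mul, le_div_iff₀' (h.mu_pos i)]
    exact hlip y hy x hx i
  have hcont2 : ContinuousOn (fun x : JointAct N d => ‖fun i => (r i)⁻¹ • (F x - x) i‖)
      (jointSet X) := by
    refine ContinuousOn.norm (continuousOn_pi.2 fun i => ?_)
    exact ((continuousOn_pi.1 hcont i).sub (continuous_apply i).continuousOn).const_smul (r i)⁻¹
  obtain ⟨x, hx, hmin⟩ := h.isCompact_jointSet.exists_isMinOn
    ⟨0, fun i => h.zero_mem i⟩ hcont2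
  set M := ‖fun i => (r i)⁻¹ • (F x - x) i‖ with hMdef
  have hle := (h.norm_weighted_le_iff (F x - x) (norm_nonneg _)).1 hMdef.ge
  rcases (norm_nonneg _ : 0 ≤ M).eq_or_lt with h0 | hM
  · have hfix : F x = x := by
      funext i
      have := hle i
      rw [← h0, mul_zero, norm_le_zero_iff] at this
      exact sub_eq_zero.1 this
    refine ⟨x, hx, fun i q hq => ?_⟩
    have := (hF x hx).2 i q hq
    rwa [hfix, Function.update_eq_self] at this
  · exfalso
    have hFx := (hF x hx).1
    have hlt : ∀ i, ‖(r i)⁻¹ • (F (F x) - F x) i‖ < M := by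
      intro i
      have h1 := hlip (F x) hFx x hx i
      have h2 := h.sum_erase_lt i hM (a := fun j => ‖F x j - x j‖) hle
      rw [norm_smul, norm_inv, Real.norm_of_nonneg (h.r_pos i).le, inv_mul_lt_iff₀ (h.r_pos i)]
      exact lt_of_mul_lt_mul_left (h1.trans_lt h2) (h.mu_pos i).le
    exact absurd ((pi_norm_lt_iff hM).2 hlt) (not_lt.2 (hmin hFx))

theorem existsUnique_isNash (h : IsQuasidominantGame R D U Uc μ r L X C) :
    ∃! x : JointAct N d, IsNash X C x := by
  obtain ⟨x, hx⟩ := h.exists_isNash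
  exact ⟨x, hx, fun y hy => h.eq_of_isNash hy hx⟩

end IsQuasidominantGame

end Game

/-! ### Moments of the uniform law on the sphere and the one-point gradient estimate -/

section Sphere

open scoped RealInnerProductSpace Pointwise

variable {d : ℕ}

/-- The action of a linear isometry on the unit sphere. -/
noncomputable def sphereIsometry (φ : Act d ≃ₗᵢ[ℝ] Act d) (s : Metric.sphere (0 : Act d) 1) :
    Metric.sphere (0 : Act d) 1 :=
  ⟨φ s, by simp⟩

theorem measurable_sphereIsometry (φ : Act d ≃ₗᵢ[ℝ] Act d) : Measurable (sphereIsometry φ) :=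
  (φ.continuous.measurable.comp measurable_subtype_coe).subtype_mk

/-- The surface measure of a set is a multiple of the volume of the cone over it, and a linear
isometry carries cones to cones and preserves volume. -/
theorem map_sphereIsometry_toSphere (φ : Act d ≃ₗᵢ[ℝ] Act d) :
    (volume : Measure (Act d)).toSphere.map (sphereIsometry φ) =
      (volume : Measure (Act d)).toSphere := by
  ext s hs
  rw [Measure.map_apply (measurable_sphereIsometry φ) hs, Measure.toSphere_apply' _ hs,
    Measure.toSphere_apply' _ (measurable_sphereIsometry φ hs)]
  congr 1
  have himg : Set.Ioo (0 : ℝ) 1 • (Subtype.val '' (sphereIsometry φ ⁻¹' s)) =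
      φ ⁻¹' (Set.Ioo (0 : ℝ) 1 • (Subtype.val '' s)) := by
    ext x
    simp only [Set.mem_smul, Set.mem_image, Set.mem_preimage]
    constructor
    · rintro ⟨c, hc, _, ⟨v, hv, rfl⟩, rfl⟩
      exact ⟨c, hc, _, ⟨_, hv, rfl⟩, by simp [sphereIsometry]⟩
    · rintro ⟨c, hc, _, ⟨v, hv, rfl⟩, hx⟩
      refine ⟨c, hc, φ.symm v, ⟨sphereIsometry φ.symm v, ?_, rfl⟩, ?_⟩
      · have : sphereIsometry φ (sphereIsometry φ.symm v) = v :=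
          Subtype.ext (φ.apply_symm_apply _)
        rwa [this]
      · apply φ.injective
        rw [← hx, map_smul, φ.apply_symm_apply]
  rw [himg, φ.measurePreserving.measure_preimage_emb φ.toHomeomorph.measurableEmbedding]

theorem map_sphereIsometry_uniformSphere (φ : Act d ≃ₗᵢ[ℝ] Act d) :
    (uniformSphere d).map (sphereIsometry φ) = uniformSphere d := by
  rw [uniformSphere, Measure.map_smul, map_sphereIsometry_toSphere]

theorem integral_uniformSphere_comp (φ : Act d ≃ₗᵢ[ℝ] Act d)
    {f : Act d → ℝ} (hf : Continuous f) :
    ∫ s, f (φ (s : Act d)) ∂uniformSphere d = ∫ s, f (s : Act d) ∂uniformSphere d := by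
  conv_rhs => rw [← map_sphereIsometry_uniformSphere φ]
  rw [integral_map (measurable_sphereIsometry φ).aemeasurable]
  · rfl
  · exact (hf.comp continuous_subtype_val).aestronglyMeasurable

theorem isProbabilityMeasure_uniformSphere (hd : 0 < d) :
    IsProbabilityMeasure (uniformSphere d) := by
  have : Nontrivial (Act d) := by
    have : Nonempty (Fin d) := ⟨⟨0, hd⟩⟩
    infer_instance
  constructor
  rw [uniformSphere, Measure.smul_apply, smul_eq_mul]
  exact ENNReal.inv_mul_cancel
    (by simpa only [ne_eq, Measure.measure_univ_eq_zero] using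
      Measure.toSphere_ne_zero (volume : Measure (Act d))) (measure_ne_top _ _)

theorem integrable_uniformSphere (hd : 0 < d) {f : Act d → ℝ} (hf : Continuous f) :
    Integrable (fun s : Metric.sphere (0 : Act d) 1 => f s) (uniformSphere d) := by
  have := isProbabilityMeasure_uniformSphere hd
  have hc : Continuous fun s : Metric.sphere (0 : Act d) 1 => f s :=
    hf.comp continuous_subtype_val
  obtain ⟨M, hM⟩ := isCompact_univ.exists_bound_of_continuousOn hc.continuousOn
  exact Integrable.of_bound hc.aestronglyMeasurable M
    (Filter.Eventually.of_forall fun s => hM s (Set.mem_univ s))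

/-- The law is invariant under `s ↦ -s`, and the integrand is odd. -/
theorem integral_inner_uniformSphere (a : Act d) :
    ∫ s, ⟪(s : Act d), a⟫ ∂uniformSphere d = 0 := by
  have h := integral_uniformSphere_comp (LinearIsometryEquiv.neg ℝ)
    (f := fun s : Act d => ⟪s, a⟫) (by fun_prop)
  simp only [LinearIsometryEquiv.coe_neg, inner_neg_left, integral_neg] at h
  linarith

/-- Vectors of equal length are exchanged by the reflection in the hyperplane orthogonal to `a - b`,
which preserves the law. -/
theorem integral_inner_sq_uniformSphere_of_norm_eq {a b : Act d} (hab : ‖a‖ = ‖b‖) :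
    ∫ s, ⟪(s : Act d), a⟫ ^ 2 ∂uniformSphere d = ∫ s, ⟪(s : Act d), b⟫ ^ 2 ∂uniformSphere d := by
  have h := integral_uniformSphere_comp ((ℝ ∙ (a - b))ᗮ.reflection)
    (f := fun s : Act d => ⟪s, b⟫ ^ 2) (by fun_prop)
  rw [← h]
  congr 1
  ext s
  have h2 := ((ℝ ∙ (a - b))ᗮ.reflection).inner_map_map (s : Act d) a
  rw [Submodule.reflection_sub hab] at h2
  rw [h2]

/-- The `d` coordinate vectors scaled to length `‖a‖` all give the same integral as `a`, and on the
unit sphere their squared inner products sum to `‖a‖ ^ 2`. -/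
theorem integral_inner_sq_uniformSphere (hd : 0 < d) (a : Act d) :
    d * ∫ s, ⟪(s : Act d), a⟫ ^ 2 ∂uniformSphere d = ‖a‖ ^ 2 := by
  have := isProbabilityMeasure_uniformSphere hd
  have hsum : ∑ k : Fin d,
      ∫ s, ⟪(s : Act d), EuclideanSpace.single k ‖a‖⟫ ^ 2 ∂uniformSphere d = ‖a‖ ^ 2 := by
    rw [← integral_finsetSum _ fun k _ => integrable_uniformSphere hd
      (f := fun s : Act d => ⟪s, EuclideanSpace.single k ‖a‖⟫ ^ 2) (by fun_prop)]
    have : ∀ s : Metric.sphere (0 : Act d) 1,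
        ∑ k : Fin d, ⟪(s : Act d), EuclideanSpace.single k ‖a‖⟫ ^ 2 = ‖a‖ ^ 2 := by
      intro s
      have h1 : ‖(s : Act d)‖ ^ 2 = 1 := by simp
      rw [EuclideanSpace.norm_sq_eq] at h1
      simp only [Real.norm_eq_abs, sq_abs] at h1
      simp only [EuclideanSpace.inner_single_right, mul_pow, ← Finset.mul_sum]
      simp [h1]
    simp [this]
  rw [← hsum, Finset.sum_congr rfl fun k _ => integral_inner_sq_uniformSphere_of_norm_eq
    (a := EuclideanSpace.single k ‖a‖) (b := a) (by simp)]
  simp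

/-- The covariance of the uniform distribution on the unit sphere is `I / d`. -/
theorem integral_inner_mul_inner_uniformSphere (hd : 0 < d) (a b : Act d) :
    d * ∫ s, ⟪(s : Act d), a⟫ * ⟪(s : Act d), b⟫ ∂uniformSphere d = ⟪a, b⟫ := by
  have h1 := integral_inner_sq_uniformSphere hd (a + b)
  have h2 := integral_inner_sq_uniformSphere hd (a - b)
  have e : ∀ s : Metric.sphere (0 : Act d) 1, ⟪(s : Act d), a⟫ * ⟪(s : Act d), b⟫ =
      1 / 4 * (⟪(s : Act d), a + b⟫ ^ 2 - ⟪(s : Act d), a - b⟫ ^ 2) := by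
    intro s; rw [inner_add_right, inner_sub_right]; ring
  simp_rw [e]
  rw [integral_const_mul, integral_sub
    (integrable_uniformSphere hd (f := fun s : Act d => ⟪s, a + b⟫ ^ 2) (by fun_prop))
    (integrable_uniformSphere hd (f := fun s : Act d => ⟪s, a - b⟫ ^ 2) (by fun_prop))]
  rw [norm_add_sq_real] at h1
  rw [norm_sub_sq_real] at h2
  linarith

/-- The one-point estimate approximates the gradient, tested against a vector. -/
theorem inner_le_integral_onePoint (hd : 0 < d) {x a g : Act d} {f : Act d → ℝ} {δ c : ℝ}
    (hδ : 0 < δ) (hmeas : Measurable fun s : Metric.sphere (0 : Act d) 1 => f (x + δ • (s : Act d)))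
    (htaylor : ∀ s : Metric.sphere (0 : Act d) 1,
      |f (x + δ • (s : Act d)) - f x - δ * ⟪g, s⟫| ≤ c * δ ^ 2) :
    Integrable (fun s : Metric.sphere (0 : Act d) 1 =>
      ⟪(d / δ * f (x + δ • (s : Act d))) • (s : Act d), a⟫) (uniformSphere d) ∧
    ⟪g, a⟫ - d * c * δ * ‖a‖ ≤
      ∫ s, ⟪(d / δ * f (x + δ • (s : Act d))) • (s : Act d), a⟫ ∂uniformSphere d := by
  have := isProbabilityMeasure_uniformSphere hd
  have hinner : ∀ s : Metric.sphere (0 : Act d) 1, ∀ b : Act d, |⟪(s : Act d), b⟫| ≤ ‖b‖ := by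
    intro s b
    simpa using abs_real_inner_le_norm (s : Act d) b
  have hdd : (0 : ℝ) < d / δ := div_pos (by exact_mod_cast hd) hδ
  have hint : Integrable (fun s : Metric.sphere (0 : Act d) 1 =>
      ⟪(d / δ * f (x + δ • (s : Act d))) • (s : Act d), a⟫) (uniformSphere d) := by
    refine Integrable.of_bound (C := d / δ * (|f x| + δ * ‖g‖ + c * δ ^ 2) * ‖a‖) ?_
      (Filter.Eventually.of_forall fun s => ?_)
    · refine Measurable.aestronglyMeasurable ?_
      have hs : Measurable fun s : Metric.sphere (0 : Act d) 1 => (s : Act d) :=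
        measurable_subtype_coe
      exact ((hmeas.const_mul (d / δ : ℝ)).smul hs).inner measurable_const
    · rw [inner_smul_left, RCLike.conj_to_real, Real.norm_eq_abs, abs_mul, abs_mul,
        abs_of_pos hdd]
      have h1 := hinner s a
      have h2 := hinner s g
      have h3 := htaylor s
      rw [real_inner_comm] at h2
      have h4 : |f (x + δ • (s : Act d))| ≤ |f x| + δ * ‖g‖ + c * δ ^ 2 := by
        have e : f (x + δ • (s : Act d)) =
          f x + δ * ⟪g, s⟫ + (f (x + δ • (s : Act d)) - f x - δ * ⟪g, s⟫) := by ring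
        rw [e]
        refine (abs_add_three _ _ _).trans ?_
        rw [abs_mul δ, abs_of_pos hδ]
        gcongr
      have h5 : 0 ≤ |f x| + δ * ‖g‖ + c * δ ^ 2 := (abs_nonneg _).trans h4
      gcongr
  refine ⟨hint, ?_⟩
  have hlow1 := integrable_uniformSphere hd (f := fun s : Act d => ⟪s, a⟫) (by fun_prop)
  have hlow2 := integrable_uniformSphere hd (f := fun s : Act d => ⟪s, g⟫ * ⟪s, a⟫) (by fun_prop)
  -- The first-order part integrates exactly: the constant term of the expansion has mean zero, and
  -- the linear term yields `⟪g, a⟫` through the covariance. The factor `d / δ` turns the Taylor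
  -- error `c * δ ^ 2` into the bias `d * c * δ * ‖a‖`.
  have hval : ∫ s : Metric.sphere (0 : Act d) 1, ((d / δ * f x) * ⟪(s : Act d), a⟫ +
      d * (⟪(s : Act d), g⟫ * ⟪(s : Act d), a⟫) - d * c * δ * ‖a‖) ∂uniformSphere d =
      ⟪g, a⟫ - d * c * δ * ‖a‖ := by
    rw [integral_sub (f := fun s : Metric.sphere (0 : Act d) 1 => (d / δ * f x) * ⟪(s : Act d), a⟫ +
      d * (⟪(s : Act d), g⟫ * ⟪(s : Act d), a⟫))
      ((hlow1.const_mul _).add (hlow2.const_mul _)) (integrable_const _), integral_add (hlow1.const_mul _) (hlow2.const_mul _), integral_const_mul,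
      integral_const_mul, integral_inner_uniformSphere,
      integral_inner_mul_inner_uniformSphere hd]
    simp
  rw [← hval]
  refine integral_mono (((hlow1.const_mul _).add (hlow2.const_mul _)).sub (integrable_const _))
    hint fun s => ?_
  have h1 := hinner s a
  have h3 := htaylor s
  set ρ := f (x + δ • (s : Act d)) - f x - δ * ⟪g, s⟫ with hρ
  have e : f (x + δ • (s : Act d)) = f x + δ * ⟪(s : Act d), g⟫ + ρ := by
    rw [hρ, real_inner_comm g]; ring
  change (d / δ * f x) * ⟪(s : Act d), a⟫ +
      d * (⟪(s : Act d), g⟫ * ⟪(s : Act d), a⟫) - d * c * δ * ‖a‖ ≤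
    ⟪(d / δ * f (x + δ • (s : Act d))) • (s : Act d), a⟫
  rw [inner_smul_left, RCLike.conj_to_real, e]
  have h5 : |ρ * ⟪(s : Act d), a⟫| ≤ c * δ ^ 2 * ‖a‖ := by
    rw [abs_mul]
    exact mul_le_mul h3 h1 (abs_nonneg _) ((abs_nonneg _).trans h3)
  have h6 := mul_le_mul_of_nonneg_left (abs_le.1 h5).1 hdd.le
  have h7 : (d / δ : ℝ) * -(c * δ ^ 2 * ‖a‖) = - (d * c * δ * ‖a‖) := by
    field_simp
  have h8 : (d / δ : ℝ) * (f x + δ * ⟪(s : Act d), g⟫ + ρ) * ⟪(s : Act d), a⟫ =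
    (d / δ * f x) * ⟪(s : Act d), a⟫ + d * (⟪(s : Act d), g⟫ * ⟪(s : Act d), a⟫) +
      d / δ * (ρ * ⟪(s : Act d), a⟫) := by
    field_simp
  rw [h8]
  linarith

end Sphere

/-! ### Metric projection onto a closed convex set -/

section Projection

open scoped RealInnerProductSpace

variable {d : ℕ} {K : Set (Act d)}

theorem projOnto_spec (hne : K.Nonempty) (hcl : IsClosed K) (hconv : Convex ℝ K) (z : Act d) :
    projOnto K z ∈ K ∧ ∀ q ∈ K, ‖z - projOnto K z‖ ≤ ‖z - q‖ := by
  have h : ∃ p ∈ K, ∀ q ∈ K, ‖z - p‖ ≤ ‖z - q‖ := by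
    obtain ⟨p, hp, he⟩ := exists_norm_eq_iInf_of_complete_convex hne hcl.isComplete hconv z
    refine ⟨p, hp, fun q hq => ?_⟩
    rw [he]
    exact ciInf_le ⟨0, Set.forall_mem_range.2 fun _ => norm_nonneg _⟩ (⟨q, hq⟩ : K)
  rw [projOnto, dif_pos h]
  exact h.choose_spec

theorem inner_sub_projOnto_nonpos (hcl : IsClosed K) (hconv : Convex ℝ K) (z : Act d) {q : Act d}
    (hq : q ∈ K) : ⟪z - projOnto K z, q - projOnto K z⟫ ≤ 0 := by
  obtain ⟨hp, hmin⟩ := projOnto_spec ⟨q, hq⟩ hcl hconv z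
  have : Nonempty K := ⟨⟨q, hq⟩⟩
  refine (norm_eq_iInf_iff_real_inner_le_zero hconv hp).1 (le_antisymm ?_ ?_) q hq
  · exact le_ciInf fun w => hmin w w.2
  · exact ciInf_le ⟨0, Set.forall_mem_range.2 fun _ => norm_nonneg _⟩ (⟨_, hp⟩ : K)

theorem norm_projOnto_sub_projOnto_le (hne : K.Nonempty) (hcl : IsClosed K) (hconv : Convex ℝ K)
    (z w : Act d) : ‖projOnto K z - projOnto K w‖ ≤ ‖z - w‖ := by
  have h1 := inner_sub_projOnto_nonpos hcl hconv z (projOnto_spec hne hcl hconv w).1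
  have h2 := inner_sub_projOnto_nonpos hcl hconv w (projOnto_spec hne hcl hconv z).1
  set p := projOnto K z
  set q := projOnto K w
  have h3 : ‖p - q‖ ^ 2 ≤ ⟪z - w, p - q⟫ := by
    rw [← real_inner_self_eq_norm_sq]
    have e : ⟪p - q, p - q⟫ = ⟪z - w, p - q⟫ + ⟪z - p, q - p⟫ + ⟪w - q, p - q⟫ := by
      simp only [inner_sub_left, inner_sub_right]; ring
    linarith
  have h4 := real_inner_le_norm (z - w) (p - q)
  rcases (norm_nonneg (p - q)).eq_or_lt with h0 | h0
  · rw [← h0]; exact norm_nonneg _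
  · nlinarith

theorem projOnto_eq_self (hcl : IsClosed K) (hconv : Convex ℝ K) {x : Act d} (hx : x ∈ K) :
    projOnto K x = x := by
  have := (projOnto_spec ⟨x, hx⟩ hcl hconv x).2 x hx
  rw [sub_self, norm_zero, norm_le_zero_iff, sub_eq_zero] at this
  exact this.symm

theorem measurable_projOnto (hne : K.Nonempty) (hcl : IsClosed K) (hconv : Convex ℝ K) :
    Measurable (projOnto K) := by
  have : LipschitzWith 1 (projOnto K) := LipschitzWith.of_dist_le_mul fun z w => by
    simpa [dist_eq_norm] using norm_projOnto_sub_projOnto_le hne hcl hconv z w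
  exact this.continuous.measurable

end Projection

/-! ### The shrunk action sets -/

section Shrunk

variable {d : ℕ} {R δ : ℝ} {X : Set (Act d)}

theorem isClosed_shrunk (hX : IsClosed X) : IsClosed (shrunk R δ X) :=
  hX.inter (hX.preimage (continuous_const_smul _))

theorem convex_shrunk (hX : Convex ℝ X) : Convex ℝ (shrunk R δ X) := by
  intro x hx y hy a b ha hb hab
  refine ⟨hX hx.1 hy.1 ha hb hab, ?_⟩
  have := hX hx.2 hy.2 ha hb hab
  rwa [smul_comm a, smul_comm b, ← smul_add] at this

/-- This makes `(1 - δ/R) • x*` an admissible comparison point for the projected steps, since the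
equilibrium itself need not lie in the shrunk sets. -/
theorem smul_mem_shrunk (hX : Convex ℝ X) (h0 : (0 : Act d) ∈ X) (hR : 0 < R) (hδ : 0 < δ)
    (hδR : δ < R) {x : Act d} (hx : x ∈ X) : (1 - δ / R) • x ∈ shrunk R δ X := by
  have h1 : δ / R < 1 := (div_lt_one hR).2 hδR
  have h2 : 0 < δ / R := div_pos hδ hR
  refine ⟨hX.smul_mem_of_zero_mem h0 hx ⟨by linarith, by linarith⟩, ?_⟩
  rwa [smul_smul, one_div_mul_cancel (by linarith), one_smul]

/-- The perturbed point is the convex combination, with weights `1 - δ/R` and `δ/R`, of `x / (1 -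
δ/R)` and `R • u`, both in `X`. Hence every play is feasible. -/
theorem add_smul_mem_of_mem_shrunk (hX : Convex ℝ X) (hball : Metric.closedBall (0 : Act d) R ⊆ X)
    (hR : 0 < R) (hδ : 0 < δ) (hδR : δ < R) {x u : Act d} (hx : x ∈ shrunk R δ X) (hu : ‖u‖ ≤ 1) :
    x + δ • u ∈ X := by
  have h1 : δ / R < 1 := (div_lt_one hR).2 hδR
  have h2 : 0 < δ / R := div_pos hδ hR
  have h3 : R • u ∈ X := hball (by
    rw [mem_closedBall_zero_iff, norm_smul, Real.norm_of_nonneg hR.le]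
    nlinarith)
  have := hX hx.2 h3 (sub_pos.2 h1).le h2.le (by ring)
  rwa [smul_smul, mul_one_div_cancel (by linarith), one_smul, smul_smul,
    div_mul_cancel₀ _ hR.ne'] at this

end Shrunk

/-! ### Pathwise estimates for the algorithm -/

section Algorithm

open scoped RealInnerProductSpace

variable {N d : ℕ} {R D U Uc δ η : ℝ} {μ r : Fin N → ℝ} {L : Fin N → Fin N → ℝ}
  {X : Fin N → Set (Act d)} {C : Fin N → JointAct N d → ℝ} {S : Fin N → Set ℕ}
  {x₁ xhat₀ : JointAct N d}

theorem zoState_succ_fst (u : Fin N → ℕ → Metric.sphere (0 : Act d) 1) (k : ℕ) :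
    (zoState R δ η X C S x₁ xhat₀ u (k + 1)).1 =
      zoUpdate R δ η X C S (k + 1) (fun i => u i (k + 1)) (zoState R δ η X C S x₁ xhat₀ u k).1
        (zoState R δ η X C S x₁ xhat₀ u (k + 1)).2 := rfl

theorem zoState_succ_snd (u : Fin N → ℕ → Metric.sphere (0 : Act d) 1) (k : ℕ) :
    (zoState R δ η X C S x₁ xhat₀ u (k + 1)).2 =
      zoPlay δ S (k + 1) (fun i => u i (k + 1)) (zoState R δ η X C S x₁ xhat₀ u k).1
        (zoState R δ η X C S x₁ xhat₀ u k).2 := rfl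

theorem zoState_succ_fst_of_notMem (u : Fin N → ℕ → Metric.sphere (0 : Act d) 1) {k : ℕ}
    {i : Fin N} (hi : k + 1 ∉ S i) : (zoState R δ η X C S x₁ xhat₀ u (k + 1)).1 i =
      (zoState R δ η X C S x₁ xhat₀ u k).1 i := by
  rw [zoState_succ_fst, zoUpdate, if_neg hi]

theorem zoState_succ_fst_of_mem (u : Fin N → ℕ → Metric.sphere (0 : Act d) 1) {k : ℕ}
    {i : Fin N} (hi : k + 1 ∈ S i) : (zoState R δ η X C S x₁ xhat₀ u (k + 1)).1 i =
      projOnto (shrunk R δ (X i)) ((zoState R δ η X C S x₁ xhat₀ u k).1 i - η • (((d : ℝ) / δ *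
        C i (zoState R δ η X C S x₁ xhat₀ u (k + 1)).2) • (u i (k + 1) : Act d))) := by
  rw [zoState_succ_fst, zoUpdate, if_pos hi]

theorem zoState_succ_snd_of_notMem (u : Fin N → ℕ → Metric.sphere (0 : Act d) 1) {k : ℕ}
    {i : Fin N} (hi : k + 1 ∉ S i) : (zoState R δ η X C S x₁ xhat₀ u (k + 1)).2 i =
      (zoState R δ η X C S x₁ xhat₀ u k).2 i := by
  rw [zoState_succ_snd, zoPlay, if_neg hi]

theorem zoState_succ_snd_of_mem (u : Fin N → ℕ → Metric.sphere (0 : Act d) 1) {k : ℕ}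
    {i : Fin N} (hi : k + 1 ∈ S i) : (zoState R δ η X C S x₁ xhat₀ u (k + 1)).2 i =
      (zoState R δ η X C S x₁ xhat₀ u k).1 i + δ • (u i (k + 1) : Act d) := by
  rw [zoState_succ_snd, zoPlay, if_pos hi]

/-- The state only depends on the directions sampled so far. -/
theorem zoState_congr {u u' : Fin N → ℕ → Metric.sphere (0 : Act d) 1} {k : ℕ}
    (huu : ∀ i, ∀ t ∈ S i, 1 ≤ t → t ≤ k → u i t = u' i t) :
    zoState R δ η X C S x₁ xhat₀ u k = zoState R δ η X C S x₁ xhat₀ u' k := by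
  induction k with
  | zero => rfl
  | succ k ih =>
    have ih' := ih fun i t ht h1 h2 => huu i t ht h1 (h2.trans k.le_succ)
    have hsnd : (zoState R δ η X C S x₁ xhat₀ u (k + 1)).2 =
        (zoState R δ η X C S x₁ xhat₀ u' (k + 1)).2 := by
      funext i
      by_cases hi : k + 1 ∈ S i
      · rw [zoState_succ_snd_of_mem _ hi, zoState_succ_snd_of_mem _ hi, ih',
          huu i (k + 1) hi (by omega) le_rfl]
      · rw [zoState_succ_snd_of_notMem _ hi, zoState_succ_snd_of_notMem _ hi, ih']
    refine Prod.ext (funext fun i => ?_) hsnd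
    by_cases hi : k + 1 ∈ S i
    · rw [zoState_succ_fst_of_mem _ hi, zoState_succ_fst_of_mem _ hi, ih', hsnd,
        huu i (k + 1) hi (by omega) le_rfl]
    · rw [zoState_succ_fst_of_notMem _ hi, zoState_succ_fst_of_notMem _ hi, ih']

/-- Resampling the direction of one active agent only changes that agent's play. -/
theorem zoState_succ_snd_of_eq_off {u u' : Fin N → ℕ → Metric.sphere (0 : Act d) 1} {k : ℕ}
    {i : Fin N} (hi : k + 1 ∈ S i)
    (huu : ∀ j, ∀ t ∈ S j, 1 ≤ t → t ≤ k + 1 → (j, t) ≠ (i, k + 1) → u j t = u' j t) :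
    (zoState R δ η X C S x₁ xhat₀ u (k + 1)).2 =
      Function.update (zoState R δ η X C S x₁ xhat₀ u' (k + 1)).2 i
        ((zoState R δ η X C S x₁ xhat₀ u' k).1 i + δ • (u i (k + 1) : Act d)) := by
  have hk : zoState R δ η X C S x₁ xhat₀ u k = zoState R δ η X C S x₁ xhat₀ u' k :=
    zoState_congr fun j t ht h1 h2 => huu j t ht h1 (h2.trans k.le_succ) (by
      intro he; have := congrArg Prod.snd he; simp only at this; omega)
  funext j
  by_cases hji : j = i
  · subst hji
    rw [Function.update_self, zoState_succ_snd_of_mem _ hi, hk]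
  · rw [Function.update_of_ne hji]
    by_cases hj : k + 1 ∈ S j
    · rw [zoState_succ_snd_of_mem _ hj, zoState_succ_snd_of_mem _ hj, hk,
        huu j (k + 1) hj (by omega) le_rfl (by simp [hji])]
    · rw [zoState_succ_snd_of_notMem _ hj, zoState_succ_snd_of_notMem _ hj, hk]

namespace IsQuasidominantGame

theorem shrunk_nonempty (h : IsQuasidominantGame R D U Uc μ r L X C) (hδ : 0 < δ) (hδR : δ < R)
    (i : Fin N) : (shrunk R δ (X i)).Nonempty :=
  ⟨_, smul_mem_shrunk (h.convex i) (h.zero_mem i) h.R_pos hδ hδR (h.zero_mem i)⟩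

theorem zoState_mem (h : IsQuasidominantGame R D U Uc μ r L X C) (hδ : 0 < δ) (hδR : δ < R)
    (hx₁ : ∀ i, x₁ i ∈ shrunk R δ (X i)) (hxhat₀ : xhat₀ ∈ jointSet X)
    (u : Fin N → ℕ → Metric.sphere (0 : Act d) 1) (k : ℕ) :
    (∀ i, (zoState R δ η X C S x₁ xhat₀ u k).1 i ∈ shrunk R δ (X i)) ∧
      (zoState R δ η X C S x₁ xhat₀ u k).2 ∈ jointSet X := by
  induction k with
  | zero => exact ⟨hx₁, hxhat₀⟩
  | succ k ih =>
    refine ⟨fun i => ?_, fun i => ?_⟩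
    · by_cases hi : k + 1 ∈ S i
      · rw [zoState_succ_fst_of_mem _ hi]
        exact (projOnto_spec (h.shrunk_nonempty hδ hδR i) (isClosed_shrunk (h.closed i))
          (convex_shrunk (h.convex i)) _).1
      · rw [zoState_succ_fst_of_notMem _ hi]; exact ih.1 i
    · by_cases hi : k + 1 ∈ S i
      · rw [zoState_succ_snd_of_mem _ hi]
        exact add_smul_mem_of_mem_shrunk (h.convex i) (h.ball_subset i) h.R_pos hδ hδR (ih.1 i)
          (by simp)
      · rw [zoState_succ_snd_of_notMem _ hi]; exact ih.2 i

theorem norm_onePoint_le (h : IsQuasidominantGame R D U Uc μ r L X C) (hδ : 0 < δ) (i : Fin N)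
    {x : JointAct N d} (hx : x ∈ jointSet X) (s : Metric.sphere (0 : Act d) 1) :
    ‖((d : ℝ) / δ * C i x) • (s : Act d)‖ ≤ d / δ * Uc := by
  rw [norm_smul, norm_eq_of_mem_sphere, mul_one, Real.norm_eq_abs, abs_mul,
    abs_of_nonneg (by positivity)]
  exact mul_le_mul_of_nonneg_left (h.cost_bound i x hx) (by positivity)

/-- Once an agent has been active, its last play is close to its iterate. -/
theorem norm_zoState_snd_sub_fst_le (h : IsQuasidominantGame R D U Uc μ r L X C) (hδ : 0 < δ)
    (hδR : δ < R) (hη : 0 ≤ η) (hx₁ : ∀ i, x₁ i ∈ shrunk R δ (X i)) (hxhat₀ : xhat₀ ∈ jointSet X)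
    (u : Fin N → ℕ → Metric.sphere (0 : Act d) 1) {k : ℕ} {i : Fin N}
    (hact : ∃ t ∈ S i, 1 ≤ t ∧ t ≤ k) :
    ‖(zoState R δ η X C S x₁ xhat₀ u k).2 i - (zoState R δ η X C S x₁ xhat₀ u k).1 i‖ ≤
      δ + η * (d / δ * Uc) := by
  induction k with
  | zero => obtain ⟨t, _, h1, h2⟩ := hact; omega
  | succ k ih =>
    -- At an active time the play is `δ` away from the old iterate and the new iterate is one
    -- projected step away from it. At an idle time neither moves, so the bound does not grow with
    -- the delay.
    by_cases hi : k + 1 ∈ S i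
    · have hmem := h.zoState_mem (S := S) (η := η) hδ hδR hx₁ hxhat₀ u
      have hne := h.shrunk_nonempty hδ hδR i
      have hcl := isClosed_shrunk (R := R) (δ := δ) (h.closed i)
      have hconv := convex_shrunk (R := R) (δ := δ) (h.convex i)
      rw [zoState_succ_fst_of_mem _ hi, zoState_succ_snd_of_mem _ hi]
      set x := (zoState R δ η X C S x₁ xhat₀ u k).1 i
      set g := ((d : ℝ) / δ * C i (zoState R δ η X C S x₁ xhat₀ u (k + 1)).2) •
        (u i (k + 1) : Act d) with hg
      have h1 := norm_projOnto_sub_projOnto_le hne hcl hconv x (x - η • g)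
      rw [projOnto_eq_self hcl hconv ((hmem k).1 i), sub_sub_cancel, norm_smul,
        Real.norm_of_nonneg hη] at h1
      have h2 : ‖g‖ ≤ d / δ * Uc := h.norm_onePoint_le hδ i (hmem (k + 1)).2 _
      have e : x + δ • (u i (k + 1) : Act d) - projOnto (shrunk R δ (X i)) (x - η • g) =
          δ • (u i (k + 1) : Act d) + (x - projOnto (shrunk R δ (X i)) (x - η • g)) := by abel
      rw [e]
      refine (norm_add_le _ _).trans (add_le_add ?_ (h1.trans ?_))
      · simp [norm_smul, abs_of_pos hδ]
      · exact mul_le_mul_of_nonneg_left h2 hη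
    · rw [zoState_succ_fst_of_notMem _ hi, zoState_succ_snd_of_notMem _ hi]
      refine ih ?_
      obtain ⟨t, ht, h1, h2⟩ := hact
      refine ⟨t, ht, h1, ?_⟩
      rcases h2.eq_or_lt with rfl | h2
      · exact absurd ht hi
      · omega

/-- The index shift matters: step `k + 1` evaluates costs at the new play while still updating the
iterate stored at index `k`. This is the discrepancy `ρ` in the drift bound. -/
theorem norm_zoState_succ_snd_sub_fst_le (h : IsQuasidominantGame R D U Uc μ r L X C)
    (hδ : 0 < δ) (hδR : δ < R) (hη : 0 ≤ η) (hx₁ : ∀ i, x₁ i ∈ shrunk R δ (X i))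
    (hxhat₀ : xhat₀ ∈ jointSet X) (u : Fin N → ℕ → Metric.sphere (0 : Act d) 1) {k : ℕ}
    {i : Fin N} (hact : ∃ t ∈ S i, 1 ≤ t ∧ t ≤ k) :
    ‖(zoState R δ η X C S x₁ xhat₀ u (k + 1)).2 i - (zoState R δ η X C S x₁ xhat₀ u k).1 i‖ ≤
      δ + η * (d / δ * Uc) := by
  by_cases hi : k + 1 ∈ S i
  · have hmem := (h.zoState_mem (S := S) (η := η) hδ hδR hx₁ hxhat₀ u (k + 1)).2
    have h2 := (norm_nonneg _).trans (h.norm_onePoint_le hδ i hmem (u i 0))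
    rw [zoState_succ_snd_of_mem _ hi, add_sub_cancel_left, norm_smul, norm_eq_of_mem_sphere,
      mul_one, Real.norm_of_nonneg hδ.le]
    have := mul_nonneg hη h2
    linarith
  · rw [zoState_succ_snd_of_notMem _ hi]
    exact h.norm_zoState_snd_sub_fst_le hδ hδR hη hx₁ hxhat₀ u hact

/-- The basic inequality of projected gradient steps. -/
theorem norm_zoState_succ_fst_sub_sq_le (h : IsQuasidominantGame R D U Uc μ r L X C)
    (hδ : 0 < δ) (hδR : δ < R) (hx₁ : ∀ i, x₁ i ∈ shrunk R δ (X i))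
    (hxhat₀ : xhat₀ ∈ jointSet X) (u : Fin N → ℕ → Metric.sphere (0 : Act d) 1) {k : ℕ}
    {i : Fin N} (hi : k + 1 ∈ S i) {y : Act d} (hy : y ∈ shrunk R δ (X i)) :
    ‖(zoState R δ η X C S x₁ xhat₀ u (k + 1)).1 i - y‖ ^ 2 ≤
      ‖(zoState R δ η X C S x₁ xhat₀ u k).1 i - y‖ ^ 2 -
      2 * η * ⟪((d : ℝ) / δ * C i (zoState R δ η X C S x₁ xhat₀ u (k + 1)).2) •
        (u i (k + 1) : Act d), (zoState R δ η X C S x₁ xhat₀ u k).1 i - y⟫ +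
      η ^ 2 * (d / δ * Uc) ^ 2 := by
  have hmem := h.zoState_mem (S := S) (η := η) hδ hδR hx₁ hxhat₀ u
  have hne := h.shrunk_nonempty hδ hδR i
  have hcl := isClosed_shrunk (R := R) (δ := δ) (h.closed i)
  have hconv := convex_shrunk (R := R) (δ := δ) (h.convex i)
  rw [zoState_succ_fst_of_mem _ hi]
  set x := (zoState R δ η X C S x₁ xhat₀ u k).1 i
  set g := ((d : ℝ) / δ * C i (zoState R δ η X C S x₁ xhat₀ u (k + 1)).2) •
    (u i (k + 1) : Act d) with hg
  have h1 := norm_projOnto_sub_projOnto_le hne hcl hconv (x - η • g) y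
  rw [projOnto_eq_self hcl hconv hy] at h1
  have h2 : ‖g‖ ≤ d / δ * Uc := h.norm_onePoint_le hδ i (hmem (k + 1)).2 _
  have h3 : ‖x - η • g - y‖ ^ 2 = ‖x - y‖ ^ 2 - 2 * η * ⟪g, x - y⟫ + η ^ 2 * ‖g‖ ^ 2 := by
    have e : x - η • g - y = (x - y) - η • g := by abel
    rw [e, norm_sub_sq_real, inner_smul_right, norm_smul, mul_pow, Real.norm_eq_abs, sq_abs,
      real_inner_comm]
    ring
  calc _ ≤ ‖x - η • g - y‖ ^ 2 := by gcongr
    _ ≤ _ := by rw [h3]; gcongr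

/-- Measurability of the iterates. -/
theorem measurable_zoState (h : IsQuasidominantGame R D U Uc μ r L X C) (hδ : 0 < δ)
    (hδR : δ < R) (hx₁ : ∀ i, x₁ i ∈ shrunk R δ (X i)) (hxhat₀ : xhat₀ ∈ jointSet X)
    {Ω : Type*} [MeasurableSpace Ω] {u : Ω → Fin N → ℕ → Metric.sphere (0 : Act d) 1}
    (hu : ∀ i t, Measurable fun ω => u ω i t) (k : ℕ) :
    (Measurable fun ω => (zoState R δ η X C S x₁ xhat₀ (u ω) k).1) ∧
      (Measurable fun ω => (zoState R δ η X C S x₁ xhat₀ (u ω) k).2) := by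
  induction k with
  | zero => exact ⟨measurable_const, measurable_const⟩
  | succ k ih =>
    have hucoe : ∀ i, Measurable fun ω => (u ω i (k + 1) : Act d) := fun i =>
      measurable_subtype_coe.comp (hu i (k + 1))
    have hsnd : Measurable fun ω => (zoState R δ η X C S x₁ xhat₀ (u ω) (k + 1)).2 := by
      refine measurable_pi_lambda _ fun i => ?_
      by_cases hi : k + 1 ∈ S i
      · simp_rw [zoState_succ_snd_of_mem _ hi]
        exact ((measurable_pi_apply i).comp ih.1).add ((hucoe i).const_smul δ)
      · simp_rw [zoState_succ_snd_of_notMem _ hi]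
        exact (measurable_pi_apply i).comp ih.2
    refine ⟨measurable_pi_lambda _ fun i => ?_, hsnd⟩
    by_cases hi : k + 1 ∈ S i
    · simp_rw [zoState_succ_fst_of_mem _ hi]
      -- Costs are measurable only on the joint action set, so feasibility of the plays enters here.
      have hcost : Measurable fun ω => C i (zoState R δ η X C S x₁ xhat₀ (u ω) (k + 1)).2 :=
        (h.measurable_cost i).comp (hsnd.subtype_mk
          (h := fun ω => (h.zoState_mem hδ hδR hx₁ hxhat₀ (u ω) (k + 1)).2))
      refine (measurable_projOnto (h.shrunk_nonempty hδ hδR i) (isClosed_shrunk (h.closed i))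
        (convex_shrunk (h.convex i))).comp ?_
      exact ((measurable_pi_apply i).comp ih.1).sub
        (((hcost.const_mul _).smul (hucoe i)).const_smul η)
    · simp_rw [zoState_succ_fst_of_notMem _ hi]
      exact (measurable_pi_apply i).comp ih.1

/-- Taylor expansion of the cost in the agent's own action. -/
theorem abs_cost_taylor_le (h : IsQuasidominantGame R D U Uc μ r L X C) (i : Fin N)
    {z : JointAct N d} (hz : z ∈ jointSet X) {x y : Act d} (hx : x ∈ X i) (hy : y ∈ X i) :
    |C i (Function.update z i y) - C i (Function.update z i x) -
      ⟪partialGrad X C i (Function.update z i x), y - x⟫| ≤ L i i * ‖y - x‖ ^ 2 := by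
  -- Convexity at `x` gives the lower bound. Convexity at `y`, with the Lipschitz bound between the
  -- two gradients, gives the upper one; the constant is `L i i` rather than half of it because
  -- nothing is integrated along the segment.
  have h1 := h.inner_partialGrad_add_le i hz hx hy
  have h2 := h.inner_partialGrad_add_le i hz hy hx
  have h3 := h.lipschitz i i _ (jointSet_update hz hx) y hy
  rw [Function.update_idem, Function.update_self] at h3
  have h4 := real_inner_le_norm (partialGrad X C i (Function.update z i y) -
    partialGrad X C i (Function.update z i x)) (y - x)
  have h5 := mul_le_mul_of_nonneg_right h3 (norm_nonneg (y - x))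
  have h6 := mul_nonneg (h.mu_pos i).le (sq_nonneg ‖y - x‖)
  have h7 := mul_nonneg (h.L_nonneg i i) (sq_nonneg ‖y - x‖)
  rw [norm_sub_rev x y, ← neg_sub y x, inner_neg_right] at h2
  rw [inner_sub_left] at h4
  rw [abs_le]
  constructor <;> nlinarith

/-- Lower bound of the drift of a gradient step at slightly outdated plays of the others. -/
theorem inner_partialGrad_outdated_ge (h : IsQuasidominantGame R D U Uc μ r L X C) (i : Fin N)
    {x z xs : JointAct N d} (hx : x ∈ jointSet X) (hz : z ∈ jointSet X) (hxs : IsNash X C xs)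
    {τ ρ : ℝ} (hτ0 : 0 ≤ τ) (hτ1 : τ ≤ 1) (hρ0 : 0 ≤ ρ) (hρ : ∀ j, ‖z j - x j‖ ≤ ρ) :
    μ i * ‖x i - (1 - τ) • xs i‖ ^ 2 - ∑ j ∈ Finset.univ.erase i,
      L i j * (‖x j - (1 - τ) • xs j‖ * ‖x i - (1 - τ) • xs i‖) -
      ((∑ j, L i j) * (ρ * D + τ * D ^ 2) + U * (τ * D)) ≤
    ⟪partialGrad X C i (Function.update z i (x i)), x i - (1 - τ) • xs i⟫ := by
  have hD := h.D_pos
  set y : JointAct N d := fun j => (1 - τ) • xs j with hy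
  have hyX : y ∈ jointSet X := fun j =>
    (h.convex j).smul_mem_of_zero_mem (h.zero_mem j) (hxs.1 j) ⟨by linarith, by linarith⟩
  have hzx := jointSet_update hz (hx i)
  have hyx := jointSet_update hyX (hx i)
  change μ i * ‖x i - y i‖ ^ 2 - ∑ j ∈ Finset.univ.erase i, L i j * (‖x j - y j‖ * ‖x i - y i‖) -
    ((∑ j, L i j) * (ρ * D + τ * D ^ 2) + U * (τ * D)) ≤
    ⟪partialGrad X C i (Function.update z i (x i)), x i - y i⟫
  set a := x i - y i with ha
  have haD : ‖a‖ ≤ D := h.diam_le i _ (hx i) _ (hyX i)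
  have hΛ : 0 ≤ ∑ j, L i j := Finset.sum_nonneg fun j _ => h.L_nonneg i j
  have hU : 0 ≤ U := (norm_nonneg _).trans (h.grad_bound i x hx)
  have hsum : ∀ b : Fin N → ℝ, ∀ m : ℝ, (∀ j, b j ≤ m) → 0 ≤ m → ∀ s : Finset (Fin N),
      ∑ j ∈ s, L i j * b j ≤ (∑ j, L i j) * m := by
    intro b m hb hm s
    calc ∑ j ∈ s, L i j * b j ≤ ∑ j ∈ s, L i j * m :=
          Finset.sum_le_sum fun j _ => mul_le_mul_of_nonneg_left (hb j) (h.L_nonneg i j)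
      _ ≤ ∑ j, L i j * m := Finset.sum_le_univ_sum_of_nonneg
          fun j => mul_nonneg (h.L_nonneg i j) hm
      _ = _ := by rw [Finset.sum_mul]
  have cs : ∀ (b c : Act d) (m : ℝ), ‖b - c‖ ≤ m → ⟪c, a⟫ - m * ‖a‖ ≤ ⟪b, a⟫ := by
    intro b c m hm
    have h1 := (abs_le.1 (abs_real_inner_le_norm (b - c) a)).1
    have h2 := mul_le_mul_of_nonneg_right hm (norm_nonneg a)
    rw [inner_sub_left] at h1
    linarith
  -- The gradient is followed along a chain of points: others at `z`, at `x`, at `y` (always with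
  -- own action `x i`), then `y`, then `xs`. The links cost the delay `ρ`, the cross terms, a gain
  -- from strong monotonicity, and the shrinkage `τ`; at `xs` the equilibrium condition gives the
  -- sign.
  have t1 := cs _ _ _ (h.norm_partialGrad_sub_le_of_eq i hx hzx (by simp))
  have t2 := cs _ _ _ (h.norm_partialGrad_sub_le_of_eq i hyx hx (by simp))
  have t3 := h.strongMonotone i hyX (hyX i) (hx i)
  rw [Function.update_eq_self, inner_sub_left] at t3
  have t4 := cs _ _ _ (h.norm_partialGrad_sub_le i hxs.1 hyX)
  have t5 := h.inner_partialGrad_nonneg i hxs.1 (hxs.1 i) (hx i) (by simpa using hxs.2 i)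
  rw [Function.update_eq_self] at t5
  have e1 : ∑ j ∈ Finset.univ.erase i, L i j * ‖Function.update z i (x i) j - x j‖ ≤
      (∑ j, L i j) * ρ := hsum _ _ (fun j => by
    by_cases hj : j = i
    · subst hj; simpa using hρ0
    · rw [Function.update_of_ne hj]; exact hρ j) hρ0 _
  have e2 : (∑ j ∈ Finset.univ.erase i, L i j * ‖x j - Function.update y i (x i) j‖) * ‖a‖ =
      ∑ j ∈ Finset.univ.erase i, L i j * (‖x j - y j‖ * ‖a‖) := by
    rw [Finset.sum_mul]
    refine Finset.sum_congr rfl fun j hj => ?_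
    rw [Function.update_of_ne (Finset.ne_of_mem_erase hj), mul_assoc]
  have hyxs : ∀ j, ‖y j - xs j‖ ≤ τ * D := by
    intro j
    have : y j - xs j = -(τ • xs j) := by rw [hy]; module
    rw [this, norm_neg, norm_smul, Real.norm_of_nonneg hτ0]
    exact mul_le_mul_of_nonneg_left (h.norm_le (hxs.1 j)) hτ0
  have e4 : ∑ j, L i j * ‖y j - xs j‖ ≤ (∑ j, L i j) * (τ * D) :=
    hsum _ _ hyxs (by positivity) _
  have t6 : -(U * (τ * D)) ≤ ⟪partialGrad X C i xs, xs i - y i⟫ := by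
    have h1 := (abs_le.1 (abs_real_inner_le_norm (partialGrad X C i xs) (xs i - y i))).1
    have h2 : ‖partialGrad X C i xs‖ * ‖xs i - y i‖ ≤ U * (τ * D) := by
      rw [norm_sub_rev]
      exact mul_le_mul (h.grad_bound i xs hxs.1) (hyxs i) (norm_nonneg _) hU
    linarith
  have t7 : ⟪partialGrad X C i xs, a⟫ = ⟪partialGrad X C i xs, x i - xs i⟫ +
      ⟪partialGrad X C i xs, xs i - y i⟫ := by
    rw [← inner_add_right, sub_add_sub_cancel]
  have e5 : (∑ j ∈ Finset.univ.erase i, L i j * ‖Function.update z i (x i) j - x j‖) * ‖a‖ ≤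
      (∑ j, L i j) * (ρ * D) := by
    rw [← mul_assoc]
    exact mul_le_mul e1 haD (norm_nonneg _) (by positivity)
  have e6 : (∑ j, L i j * ‖y j - xs j‖) * ‖a‖ ≤ (∑ j, L i j) * (τ * D ^ 2) := by
    calc _ ≤ ((∑ j, L i j) * (τ * D)) * D :=
          mul_le_mul e4 haD (norm_nonneg _) (by positivity)
      _ = _ := by ring
  rw [e2] at t2
  rw [mul_add (∑ j, L i j)]
  linarith

end IsQuasidominantGame

end Algorithm

/-- Resampling one coordinate preserves a product of identical probability measures. -/
theorem measurePreserving_update_pi {ι α : Type*} [Fintype ι] [DecidableEq ι] [MeasurableSpace α]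
    (σ : Measure α) [IsProbabilityMeasure σ] (p : ι) :
    MeasurePreserving (fun q : (ι → α) × α => Function.update q.1 p q.2)
      ((Measure.pi fun _ : ι => σ).prod σ) (Measure.pi fun _ : ι => σ) := by
  have hmeas : Measurable (fun q : (ι → α) × α => Function.update q.1 p q.2) := by
    refine measurable_pi_lambda _ fun j => ?_
    by_cases hj : j = p
    · subst hj; simpa using measurable_snd
    · simpa [hj, Function.comp_def] using (measurable_pi_apply j).comp measurable_fst
  refine ⟨hmeas, (Measure.pi_eq fun s hs => ?_).symm⟩
  rw [Measure.map_apply hmeas (MeasurableSet.univ_pi hs)]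
  have hpre : (fun q : (ι → α) × α => Function.update q.1 p q.2) ⁻¹' Set.univ.pi s =
      (Set.univ.pi (Function.update s p Set.univ)) ×ˢ s p := by
    ext ⟨w, a⟩
    simp only [Set.mem_preimage, Set.mem_univ_pi, Set.mem_prod]
    constructor
    · intro hw
      refine ⟨fun j => ?_, by simpa using hw p⟩
      by_cases hj : j = p
      · subst hj; simp
      · simpa [hj] using hw j
    · rintro ⟨hw, ha⟩ j
      by_cases hj : j = p
      · subst hj; simpa using ha
      · simpa [hj] using hw j
  rw [hpre, Measure.prod_prod, Measure.pi_pi, ← Finset.mul_prod_erase _ _ (Finset.mem_univ p),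
    ← Finset.mul_prod_erase _ (fun i => σ (s i)) (Finset.mem_univ p), Function.update_self,
    measure_univ, one_mul, mul_comm]
  congr 1
  refine Finset.prod_congr rfl fun j hj => ?_
  rw [Function.update_of_ne (Finset.ne_of_mem_erase hj)]

/-- This plays the role of conditioning on all directions but one: the fresh direction is integrated
first, with the others frozen. -/
theorem integral_pi_eq_integral_update {ι α : Type*} [Fintype ι] [DecidableEq ι]
    [MeasurableSpace α] (σ : Measure α) [IsProbabilityMeasure σ] (p : ι) {F : (ι → α) → ℝ}
    (hF : Measurable F) (hint : Integrable F (Measure.pi fun _ : ι => σ)) :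
    Integrable (fun w => ∫ s, F (Function.update w p s) ∂σ) (Measure.pi fun _ : ι => σ) ∧
    ∫ w, F w ∂(Measure.pi fun _ : ι => σ) =
      ∫ w, ∫ s, F (Function.update w p s) ∂σ ∂(Measure.pi fun _ : ι => σ) := by
  have hmp := measurePreserving_update_pi σ p
  have hint2 := hmp.integrable_comp_of_integrable hint
  refine ⟨hint2.integral_prod_left, ?_⟩
  conv_lhs => rw [← hmp.map_eq]
  rw [integral_map hmp.measurable.aemeasurable hF.aestronglyMeasurable]
  exact integral_prod _ hint2

/-! ### Expected progress of one update -/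

section Sampling

open scoped RealInnerProductSpace

variable {N d T : ℕ} {R D U Uc δ η : ℝ} {μ r : Fin N → ℝ} {L : Fin N → Fin N → ℝ}
  {X : Fin N → Set (Act d)} {C : Fin N → JointAct N d → ℝ} {S : Fin N → Set ℕ}
  {x₁ xhat₀ : JointAct N d}

instance finite_activePair : Finite (ActivePair S T) := by
  refine Finite.of_injective (β := Fin N × Fin (T + 1))
    (fun p => (p.1.1, ⟨p.1.2, Nat.lt_succ_of_le p.2.2.2⟩)) fun p q hpq => ?_
  simp only [Prod.mk.injEq, Fin.mk.injEq] at hpq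
  exact Subtype.ext (Prod.ext hpq.1 hpq.2)

open Classical in
/-- Extend directions sampled at active pairs by an arbitrary direction. -/
noncomputable def extendSample (s₀ : Metric.sphere (0 : Act d) 1)
    (w : ActivePair S T → Metric.sphere (0 : Act d) 1) (i : Fin N) (t : ℕ) :
    Metric.sphere (0 : Act d) 1 :=
  if h : t ∈ S i ∧ 1 ≤ t ∧ t ≤ T then w ⟨(i, t), h⟩ else s₀

theorem extendSample_of_active (s₀ : Metric.sphere (0 : Act d) 1)
    (w : ActivePair S T → Metric.sphere (0 : Act d) 1) {i : Fin N} {t : ℕ}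
    (h : t ∈ S i ∧ 1 ≤ t ∧ t ≤ T) : extendSample s₀ w i t = w ⟨(i, t), h⟩ :=
  dif_pos h

theorem measurable_extendSample (s₀ : Metric.sphere (0 : Act d) 1) (i : Fin N) (t : ℕ) :
    Measurable fun w : ActivePair S T → Metric.sphere (0 : Act d) 1 => extendSample s₀ w i t := by
  by_cases h : t ∈ S i ∧ 1 ≤ t ∧ t ≤ T
  · simp_rw [extendSample_of_active s₀ _ h]; exact measurable_pi_apply _
  · simp only [extendSample, dif_neg h]; exact measurable_const

namespace IsQuasidominantGame

theorem measurable_sqDist (h : IsQuasidominantGame R D U Uc μ r L X C) (hδ : 0 < δ)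
    (hδR : δ < R) (hx₁ : ∀ i, x₁ i ∈ shrunk R δ (X i)) (hxhat₀ : xhat₀ ∈ jointSet X)
    (s₀ : Metric.sphere (0 : Act d) 1) (k : ℕ) (i : Fin N) (y : Act d) :
    Measurable fun w : ActivePair S T → Metric.sphere (0 : Act d) 1 =>
      ‖(zoState R δ η X C S x₁ xhat₀ (extendSample s₀ w) k).1 i - y‖ ^ 2 := by
  have := (h.measurable_zoState (S := S) (η := η) hδ hδR hx₁ hxhat₀
    (u := fun w : ActivePair S T → Metric.sphere (0 : Act d) 1 => extendSample s₀ w)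
    (measurable_extendSample s₀) k).1
  exact ((((measurable_pi_apply i).comp this).sub_const y).norm).pow_const 2

theorem sqDist_le (h : IsQuasidominantGame R D U Uc μ r L X C) (hδ : 0 < δ)
    (hδR : δ < R) (hx₁ : ∀ i, x₁ i ∈ shrunk R δ (X i)) (hxhat₀ : xhat₀ ∈ jointSet X)
    (u : Fin N → ℕ → Metric.sphere (0 : Act d) 1) (k : ℕ) {i : Fin N} {y : Act d} (hy : y ∈ X i) :
    ‖(zoState R δ η X C S x₁ xhat₀ u k).1 i - y‖ ^ 2 ≤ D ^ 2 := by
  have := h.diam_le i _ ((h.zoState_mem (S := S) (η := η) hδ hδR hx₁ hxhat₀ u k).1 i).1 y hy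
  gcongr

theorem integrable_sqDist (h : IsQuasidominantGame R D U Uc μ r L X C) (hδ : 0 < δ)
    (hδR : δ < R) (hx₁ : ∀ i, x₁ i ∈ shrunk R δ (X i)) (hxhat₀ : xhat₀ ∈ jointSet X)
    (s₀ : Metric.sphere (0 : Act d) 1) (k : ℕ) {i : Fin N} {y : Act d} (hy : y ∈ X i)
    (ν : Measure (ActivePair S T → Metric.sphere (0 : Act d) 1)) [IsFiniteMeasure ν] :
    Integrable (fun w => ‖(zoState R δ η X C S x₁ xhat₀ (extendSample s₀ w) k).1 i - y‖ ^ 2) ν := by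
  refine Integrable.of_bound
    (h.measurable_sqDist hδ hδR hx₁ hxhat₀ s₀ k i y).aestronglyMeasurable (D ^ 2)
    (Filter.Eventually.of_forall fun w => ?_)
  rw [Real.norm_of_nonneg (by positivity)]
  exact h.sqDist_le hδ hδR hx₁ hxhat₀ _ k hy

/-- Mean of one projected step over the direction sampled by the agent. -/
theorem integral_resampled_step_le (h : IsQuasidominantGame R D U Uc μ r L X C) (hd : 0 < d)
    (hδ : 0 < δ) (hδR : δ < R) (hη : 0 ≤ η) (hx₁ : ∀ i, x₁ i ∈ shrunk R δ (X i))
    (hxhat₀ : xhat₀ ∈ jointSet X) (s₀ : Metric.sphere (0 : Act d) 1) {k : ℕ} (hkT : k + 1 ≤ T)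
    {i : Fin N} (hi : k + 1 ∈ S i) {y : Act d} (hy : y ∈ shrunk R δ (X i))
    (w : ActivePair S T → Metric.sphere (0 : Act d) 1) :
    ∫ s, ‖(zoState R δ η X C S x₁ xhat₀ (extendSample s₀
      (Function.update w ⟨(i, k + 1), hi, by omega, hkT⟩ s)) (k + 1)).1 i - y‖ ^ 2
      ∂uniformSphere d ≤
    ‖(zoState R δ η X C S x₁ xhat₀ (extendSample s₀ w) k).1 i - y‖ ^ 2 - 2 * η *
      (⟪partialGrad X C i (Function.update
        (zoState R δ η X C S x₁ xhat₀ (extendSample s₀ w) (k + 1)).2 i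
        ((zoState R δ η X C S x₁ xhat₀ (extendSample s₀ w) k).1 i)),
        (zoState R δ η X C S x₁ xhat₀ (extendSample s₀ w) k).1 i - y⟫ - d * L i i * δ * D) +
      η ^ 2 * (d / δ * Uc) ^ 2 := by
  have := isProbabilityMeasure_uniformSphere hd
  set p : ActivePair S T := ⟨(i, k + 1), hi, by omega, hkT⟩ with hp
  have hoff : ∀ s, ∀ j, ∀ t ∈ S j, 1 ≤ t → t ≤ k + 1 → (j, t) ≠ (i, k + 1) →
      extendSample s₀ (Function.update w p s) j t = extendSample s₀ w j t := by
    intro s j t ht h1 h2 hne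
    rw [extendSample_of_active _ _ ⟨ht, h1, h2.trans hkT⟩,
      extendSample_of_active _ _ ⟨ht, h1, h2.trans hkT⟩, Function.update_of_ne]
    intro he
    exact hne (congrArg Subtype.val he)
  have hon : ∀ s, extendSample s₀ (Function.update w p s) i (k + 1) = s := by
    intro s
    rw [extendSample_of_active _ _ ⟨hi, by omega, hkT⟩]
    exact Function.update_self _ _ _
  -- The resampled direction is used first at step `k + 1`, so the past, and the other agents' plays
  -- at that step, are constants for the inner integral.
  have hfst : ∀ s, zoState R δ η X C S x₁ xhat₀ (extendSample s₀ (Function.update w p s)) k =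
      zoState R δ η X C S x₁ xhat₀ (extendSample s₀ w) k := fun s =>
    zoState_congr fun j t ht h1 h2 => hoff s j t ht h1 (h2.trans k.le_succ) (by
      intro he; have := congrArg Prod.snd he; simp only at this; omega)
  have hsnd : ∀ s, (zoState R δ η X C S x₁ xhat₀
      (extendSample s₀ (Function.update w p s)) (k + 1)).2 =
      Function.update (zoState R δ η X C S x₁ xhat₀ (extendSample s₀ w) (k + 1)).2 i
        ((zoState R δ η X C S x₁ xhat₀ (extendSample s₀ w) k).1 i + δ • (s : Act d)) := by
    intro s
    rw [zoState_succ_snd_of_eq_off hi (hoff s), hon]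
  have hstep : ∀ s, _ ≤ _ := fun s => h.norm_zoState_succ_fst_sub_sq_le (η := η) hδ hδR hx₁ hxhat₀
    (extendSample s₀ (Function.update w p s)) hi hy
  simp only [hfst, hsnd, hon] at hstep
  have hmem := h.zoState_mem (S := S) (η := η) hδ hδR hx₁ hxhat₀ (extendSample s₀ w)
  have hz := (hmem (k + 1)).2
  have hxsh := (hmem k).1 i
  set x := (zoState R δ η X C S x₁ xhat₀ (extendSample s₀ w) k).1 i with hxdef
  set z := (zoState R δ η X C S x₁ xhat₀ (extendSample s₀ w) (k + 1)).2 with hzdef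
  have hplay : ∀ s : Metric.sphere (0 : Act d) 1, x + δ • (s : Act d) ∈ X i := fun s =>
    add_smul_mem_of_mem_shrunk (h.convex i) (h.ball_subset i) h.R_pos hδ hδR hxsh (by simp)
  have hmeasf : Measurable fun s : Metric.sphere (0 : Act d) 1 =>
      C i (Function.update z i (x + δ • (s : Act d))) := by
    have hm : Measurable fun s : Metric.sphere (0 : Act d) 1 =>
        Function.update z i (x + δ • (s : Act d)) :=
      (measurable_update z).comp ((measurable_subtype_coe.const_smul δ).const_add x)
    exact (h.measurable_cost i).comp
      (hm.subtype_mk (h := fun s => jointSet_update hz (hplay s)))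
  obtain ⟨hint, hlow⟩ := inner_le_integral_onePoint hd (x := x) (a := x - y)
    (g := partialGrad X C i (Function.update z i x)) (f := fun v => C i (Function.update z i v))
    (c := L i i) hδ hmeasf (fun s => by
      have := h.abs_cost_taylor_le i hz hxsh.1 (hplay s)
      rw [add_sub_cancel_left, inner_smul_right, norm_smul, norm_eq_of_mem_sphere, mul_one,
        Real.norm_of_nonneg hδ.le] at this
      exact this)
  have hmeasF : Measurable fun s : Metric.sphere (0 : Act d) 1 =>
      ‖(zoState R δ η X C S x₁ xhat₀ (extendSample s₀ (Function.update w p s)) (k + 1)).1 i - y‖ ^ 2 :=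
    (h.measurable_sqDist hδ hδR hx₁ hxhat₀ s₀ (k + 1) i y).comp (measurable_update w)
  have hintF : Integrable (fun s : Metric.sphere (0 : Act d) 1 =>
      ‖(zoState R δ η X C S x₁ xhat₀ (extendSample s₀ (Function.update w p s)) (k + 1)).1 i -
        y‖ ^ 2) (uniformSphere d) := by
    refine Integrable.of_bound hmeasF.aestronglyMeasurable (D ^ 2)
      (Filter.Eventually.of_forall fun s => ?_)
    rw [Real.norm_of_nonneg (by positivity)]
    exact h.sqDist_le hδ hδR hx₁ hxhat₀ _ (k + 1) hy.1
  have hmono := integral_mono hintF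
    (((integrable_const (‖x - y‖ ^ 2)).sub (hint.const_mul (2 * η))).add
      (integrable_const (η ^ 2 * (d / δ * Uc) ^ 2))) hstep
  refine hmono.trans ?_
  rw [integral_add' ((integrable_const _).sub (hint.const_mul (2 * η))) (integrable_const _),
    integral_sub' (integrable_const _) (hint.const_mul (2 * η)), integral_const_mul]
  simp only [integral_const, probReal_univ, one_smul]
  have hxy : ‖x - y‖ ≤ D := h.diam_le i _ hxsh.1 _ hy.1
  have h1 : d * L i i * δ * ‖x - y‖ ≤ d * L i i * δ * D :=
    mul_le_mul_of_nonneg_left hxy (by have := h.L_nonneg i i; positivity)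
  have h2 := mul_le_mul_of_nonneg_left (hlow.trans' (sub_le_sub_left h1 _))
    (by positivity : 0 ≤ 2 * η)
  linarith

/-- One step of an active agent in expectation, once all agents have been active. -/
theorem integral_step_le (h : IsQuasidominantGame R D U Uc μ r L X C) (hd : 0 < d)
    (hδ : 0 < δ) (hδR : δ < R) (hη : 0 ≤ η) (hx₁ : ∀ i, x₁ i ∈ shrunk R δ (X i))
    (hxhat₀ : xhat₀ ∈ jointSet X) (s₀ : Metric.sphere (0 : Act d) 1) {k : ℕ} (hkT : k + 1 ≤ T)
    (hact : ∀ j, ∃ t ∈ S j, 1 ≤ t ∧ t ≤ k) {i : Fin N} (hi : k + 1 ∈ S i)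
    {xs : JointAct N d} (hxs : IsNash X C xs) [Fintype (ActivePair S T)]
    {V : Fin N → ℕ → ℝ} (hV : V = fun j l => ∫ w, ‖(zoState R δ η X C S x₁ xhat₀
      (extendSample s₀ w) l).1 j - (1 - δ / R) • xs j‖ ^ 2
      ∂Measure.pi fun _ : ActivePair S T => uniformSphere d) :
    V i (k + 1) ≤ V i k - 2 * η * (μ i * V i k - ∑ j ∈ Finset.univ.erase i,
      L i j * (r i * r j / 2 * (V j k / r j ^ 2 + V i k / r i ^ 2)) -
      ((∑ j, L i j) * ((δ + η * (d / δ * Uc)) * D + δ / R * D ^ 2) + U * (δ / R * D) +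
        d * L i i * δ * D)) + η ^ 2 * (d / δ * Uc) ^ 2 := by
  have := isProbabilityMeasure_uniformSphere hd
  set ν := Measure.pi fun _ : ActivePair S T => uniformSphere d
  set v : Fin N → (ActivePair S T → Metric.sphere (0 : Act d) 1) → ℝ := fun j w =>
    ‖(zoState R δ η X C S x₁ xhat₀ (extendSample s₀ w) k).1 j - (1 - δ / R) • xs j‖ ^ 2 with hv
  set ρ := δ + η * (d / δ * Uc) with hρ
  set τ := δ / R with hτ
  set E := (∑ j, L i j) * (ρ * D + τ * D ^ 2) + U * (τ * D) + d * L i i * δ * D with hE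
  have hτ0 : 0 ≤ τ := div_nonneg hδ.le h.R_pos.le
  have hτ1 : τ ≤ 1 := (div_le_one h.R_pos).2 hδR.le
  have hUc : 0 ≤ Uc := (abs_nonneg _).trans (h.cost_bound i xs hxs.1)
  have hρ0 : 0 ≤ ρ := by positivity
  have hysh : ∀ j, (1 - τ) • xs j ∈ shrunk R δ (X j) := fun j =>
    smul_mem_shrunk (h.convex j) (h.zero_mem j) h.R_pos hδ hδR (hxs.1 j)
  have hvint : ∀ j, Integrable (v j) ν := fun j =>
    h.integrable_sqDist hδ hδR hx₁ hxhat₀ s₀ k (hysh j).1 ν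
  have hVk : ∀ j, V j k = ∫ w, v j w ∂ν := fun j => by rw [hV]
  have hVk1 : V i (k + 1) = ∫ w, ‖(zoState R δ η X C S x₁ xhat₀
      (extendSample s₀ w) (k + 1)).1 i - (1 - τ) • xs i‖ ^ 2 ∂ν := by rw [hV]
  -- Only the active agent's own direction is averaged; the perturbations of the others are absorbed
  -- into `ρ`.
  obtain ⟨hint, heq⟩ := integral_pi_eq_integral_update (uniformSphere d)
    (⟨(i, k + 1), hi, by omega, hkT⟩ : ActivePair S T)
    (h.measurable_sqDist (S := S) (T := T) (η := η) hδ hδR hx₁ hxhat₀ s₀ (k + 1) i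
      ((1 - τ) • xs i))
    (h.integrable_sqDist hδ hδR hx₁ hxhat₀ s₀ (k + 1) (hysh i).1 ν)
  have htermint : ∀ j, Integrable (fun w =>
      L i j * (r i * r j / 2 * (v j w / r j ^ 2 + v i w / r i ^ 2))) ν := fun j =>
    ((((hvint j).div_const _).add ((hvint i).div_const _)).const_mul _).const_mul _
  have hsumint : Integrable (fun w => ∑ j ∈ Finset.univ.erase i,
      L i j * (r i * r j / 2 * (v j w / r j ^ 2 + v i w / r i ^ 2))) ν :=
    integrable_finsetSum _ fun j _ => htermint j
  have hbr₀ : Integrable (fun w => μ i * v i w - ∑ j ∈ Finset.univ.erase i,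
      L i j * (r i * r j / 2 * (v j w / r j ^ 2 + v i w / r i ^ 2))) ν :=
    ((hvint i).const_mul _).sub hsumint
  have hbr : Integrable (fun w => μ i * v i w - ∑ j ∈ Finset.univ.erase i,
      L i j * (r i * r j / 2 * (v j w / r j ^ 2 + v i w / r i ^ 2)) - E) ν :=
    hbr₀.sub (integrable_const _)
  have hpt : ∀ w, ∫ s, ‖(zoState R δ η X C S x₁ xhat₀ (extendSample s₀
      (Function.update w ⟨(i, k + 1), hi, by omega, hkT⟩ s)) (k + 1)).1 i - (1 - τ) • xs i‖ ^ 2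
      ∂uniformSphere d ≤ v i w - 2 * η * (μ i * v i w - ∑ j ∈ Finset.univ.erase i,
      L i j * (r i * r j / 2 * (v j w / r j ^ 2 + v i w / r i ^ 2)) - E) +
      η ^ 2 * (d / δ * Uc) ^ 2 := by
    intro w
    refine (h.integral_resampled_step_le hd hδ hδR hη hx₁ hxhat₀ s₀ hkT hi (hysh i) w).trans ?_
    have hmem := h.zoState_mem (S := S) (η := η) hδ hδR hx₁ hxhat₀ (extendSample s₀ w)
    have hdrift := h.inner_partialGrad_outdated_ge i (fun j => ((hmem k).1 j).1)
      (hmem (k + 1)).2 hxs hτ0 hτ1 hρ0 (fun j =>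
        h.norm_zoState_succ_snd_sub_fst_le hδ hδR hη hx₁ hxhat₀ (extendSample s₀ w) (hact j))
    -- AM-GM applied to `a / r j` and `b / r i`, so that the cross terms involve only the weighted
    -- squares `V j / r j ^ 2` and quasidominance can be used.
    have hamgm : ∑ j ∈ Finset.univ.erase i, L i j *
        (‖(zoState R δ η X C S x₁ xhat₀ (extendSample s₀ w) k).1 j - (1 - τ) • xs j‖ *
        ‖(zoState R δ η X C S x₁ xhat₀ (extendSample s₀ w) k).1 i - (1 - τ) • xs i‖) ≤
        ∑ j ∈ Finset.univ.erase i,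
          L i j * (r i * r j / 2 * (v j w / r j ^ 2 + v i w / r i ^ 2)) := by
      refine Finset.sum_le_sum fun j _ => mul_le_mul_of_nonneg_left ?_ (h.L_nonneg i j)
      have hri := h.r_pos i
      have hrj := h.r_pos j
      simp only [hv]
      generalize ‖(zoState R δ η X C S x₁ xhat₀ (extendSample s₀ w) k).1 j - (1 - τ) • xs j‖ = a
      generalize ‖(zoState R δ η X C S x₁ xhat₀ (extendSample s₀ w) k).1 i - (1 - τ) • xs i‖ = b
      have e : r i * r j / 2 * (a ^ 2 / r j ^ 2 + b ^ 2 / r i ^ 2) - a * b =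
          r i * r j / 2 * (a / r j - b / r i) ^ 2 := by
        field_simp; ring
      have : 0 ≤ r i * r j / 2 * (a / r j - b / r i) ^ 2 := by positivity
      linarith
    have hfin := mul_le_mul_of_nonneg_left
      ((sub_le_sub_left hamgm _).trans (sub_le_iff_le_add.1 hdrift)) (by positivity : 0 ≤ 2 * η)
    simp only [hv, hE] at hfin ⊢
    linarith
  rw [hVk1]
  refine heq.trans_le ((integral_mono (μ := ν) hint (((hvint i).sub (hbr.const_mul (2 * η))).add
    (integrable_const (η ^ 2 * (d / δ * Uc) ^ 2))) hpt).trans_eq ?_)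
  rw [integral_add' ((hvint i).sub (hbr.const_mul (2 * η))) (integrable_const _),
    integral_sub' (hvint i) (hbr.const_mul (2 * η)), integral_const_mul,
    integral_sub hbr₀ (integrable_const _),
    integral_sub ((hvint i).const_mul _) hsumint, integral_const_mul,
    integral_finsetSum _ fun j _ => htermint j]
  have hterm : ∀ j, ∫ w, L i j * (r i * r j / 2 * (v j w / r j ^ 2 + v i w / r i ^ 2)) ∂ν =
      L i j * (r i * r j / 2 * (V j k / r j ^ 2 + V i k / r i ^ 2)) := by
    intro j
    rw [integral_const_mul, integral_const_mul, integral_add ((hvint j).div_const _)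
      ((hvint i).div_const _), integral_div, integral_div, hVk, hVk]
  simp only [hterm, integral_const, probReal_univ, one_smul, hVk]

end IsQuasidominantGame

/-- Transfer of an expectation over the sampled directions to the product of uniform measures. -/
theorem IsUniformSampling.map_eq_pi {Ω : Type*} [MeasurableSpace Ω] {P : Measure Ω}
    [IsProbabilityMeasure P] {u : Fin N → ℕ → Ω → Metric.sphere (0 : Act d) 1}
    (hu : IsUniformSampling P S T u) [Fintype (ActivePair S T)] :
    P.map (fun ω (p : ActivePair S T) => u p.1.1 p.1.2 ω) =
      Measure.pi fun _ : ActivePair S T => uniformSphere d := by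
  rw [(iIndepFun_iff_map_fun_eq_pi_map fun p => (hu.measurable p).aemeasurable).1 hu.indep]
  simp_rw [hu.law]

end Sampling

/-! ### Contraction along asynchronous windows -/

section Recursion

variable {N : ℕ} {S : Fin N → Set ℕ} {B k₀ K : ℕ} {Y : Fin N → ℕ → ℝ} {c q : ℝ}

/-- Since `q ≤ 1`, the common level `c + A` is never exceeded, so every update in the window may use
it. Whoever has updated is below `c + q * A`, and idling preserves this. -/
theorem window_bound (hq1 : q ≤ 1) (hstay : ∀ k i, k + 1 ∉ S i → Y i (k + 1) = Y i k)
    (hstep : ∀ k, k₀ ≤ k → k + 1 ≤ K → ∀ i, k + 1 ∈ S i → ∀ A, 0 ≤ A →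
      (∀ j, Y j k ≤ c + A) → Y i (k + 1) ≤ c + q * A)
    {A : ℝ} (hA : 0 ≤ A) {k : ℕ} (hk : k₀ ≤ k) (h0 : ∀ j, Y j k ≤ c + A) (m : ℕ)
    (hm : k + m ≤ K) (j : Fin N) : Y j (k + m) ≤ c + A ∧
      ((∃ s ∈ S j, k < s ∧ s ≤ k + m) → Y j (k + m) ≤ c + q * A) := by
  induction m generalizing j with
  | zero => exact ⟨h0 j, fun ⟨s, _, h1, h2⟩ => by omega⟩
  | succ m ih =>
    have ih' := ih (by omega)
    by_cases hj : k + m + 1 ∈ S j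
    · have h1 := hstep (k + m) (by omega) (by omega) j hj A hA fun i => (ih' i).1
      have h2 : q * A ≤ A := mul_le_of_le_one_left hA hq1
      exact ⟨h1.trans (by linarith), fun _ => h1⟩
    · rw [← add_assoc, hstay _ _ hj]
      refine ⟨(ih' j).1, fun ⟨s, hs, h1, h2⟩ => (ih' j).2 ⟨s, hs, h1, ?_⟩⟩
      rcases h2.eq_or_lt with rfl | h2
      · exact absurd hs hj
      · omega

/-- A recursion that contracts at every update of an agent contracts geometrically along
windows in which all agents are active. -/
theorem window_contraction (hS : PartiallyAsynchronous S B) (hq0 : 0 ≤ q) (hq1 : q ≤ 1)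
    (hstay : ∀ k i, k + 1 ∉ S i → Y i (k + 1) = Y i k)
    (hstep : ∀ k, k₀ ≤ k → k + 1 ≤ K → ∀ i, k + 1 ∈ S i → ∀ A, 0 ≤ A →
      (∀ j, Y j k ≤ c + A) → Y i (k + 1) ≤ c + q * A)
    {A : ℝ} (hA : 0 ≤ A) (h0 : ∀ j, Y j k₀ ≤ c + A) (n : ℕ) :
    ∀ k, k₀ + n * B ≤ k → k ≤ K → ∀ j, Y j k ≤ c + q ^ n * A := by
  induction n with
  | zero =>
    intro k hk hkK j
    obtain ⟨m, rfl⟩ := Nat.exists_eq_add_of_le (show k₀ ≤ k by omega)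
    simpa using (window_bound hq1 hstay hstep hA le_rfl h0 m hkK j).1
  | succ n ih =>
    intro k hk hkK j
    rw [Nat.succ_mul] at hk
    obtain ⟨m, rfl⟩ := Nat.exists_eq_add_of_le (show k₀ + n * B ≤ k by omega)
    have h1 := ih (k₀ + n * B) le_rfl (by omega)
    have h2 := (window_bound hq1 hstay hstep (by positivity) (by omega) h1 m hkK j).2 ?_
    · rwa [← mul_assoc, ← pow_succ'] at h2
    · obtain ⟨s, hs, hs1, hs2⟩ := hS j (k₀ + n * B + 1) (by omega)
      exact ⟨s, hs, by omega, by omega⟩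

end Recursion

/-! ### Estimates for the chosen parameters -/

section Schedule

variable {B T : ℕ}

/-- From `log x ≥ 1 - 1/x` the product is at least `B (T - B) / T`. Either `T - B ≥ T / 2`, or `B ≥
T / 2` and `T - B ≥ 1`. The bound lets terms without a logarithm be absorbed into the rate. -/
theorem half_le_mul_log (hB : 1 ≤ B) (hBT : B < T) :
    1 / 2 ≤ (B : ℝ) * Real.log ((T : ℝ) / B) := by
  have hB' : (1 : ℝ) ≤ B := by exact_mod_cast hB
  have hBT' : (B : ℝ) + 1 ≤ T := by exact_mod_cast hBT
  have hT : (0 : ℝ) < T := by linarith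
  have h1 := Real.one_sub_inv_le_log_of_pos (show (0 : ℝ) < T / B by positivity)
  rw [inv_div] at h1
  refine le_trans ?_ (mul_le_mul_of_nonneg_left h1 (by linarith : (0 : ℝ) ≤ B))
  have e : (B : ℝ) * (1 - B / T) = B * (T - B) / T := by field_simp
  rw [e, le_div_iff₀ hT]
  rcases le_total (2 * (B : ℝ)) T with h | h <;> nlinarith

/-- With `l = log (T / B)`, the exponent is at least `T / B - 2`, so its product with `z` is at
least `2 l - 4 B l / T ≥ 2 l - 4`, because `l ≤ T / B`. This is the origin of `exp 4`. -/
theorem one_sub_pow_le_of_schedule (hB : 1 ≤ B) (hBT : B < T) {z : ℝ} (hz1 : z ≤ 1)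
    (hz : z = 2 * (B * Real.log ((T : ℝ) / B) / T)) :
    (1 - z) ^ ((T - 1 - B) / B) ≤ Real.exp 4 * (B / T) ^ 2 := by
  have hB' : (1 : ℝ) ≤ B := by exact_mod_cast hB
  have hBT' : (B : ℝ) + 1 ≤ T := by exact_mod_cast hBT
  have hT : (0 : ℝ) < T := by linarith
  set n := (T - 1 - B) / B with hn
  set l := Real.log ((T : ℝ) / B) with hl
  have hx : (0 : ℝ) < T / B := by positivity
  have hl0 : 0 ≤ l := Real.log_nonneg ((one_le_div (by linarith)).2 (by linarith))
  have hl1 : l ≤ T / B := (Real.log_le_sub_one_of_pos hx).trans (by linarith)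
  have hlB : B * l ≤ T := by
    have := mul_le_mul_of_nonneg_left hl1 (by linarith : (0 : ℝ) ≤ B)
    rwa [mul_div_cancel₀ _ (by linarith : (B : ℝ) ≠ 0)] at this
  have hnB : (T : ℝ) - 2 * B ≤ n * B := by
    have h1 : T - 1 - B < B * (n + 1) := Nat.lt_mul_div_succ _ (by omega)
    have h2 : T ≤ n * B + 2 * B := by
      rw [Nat.mul_succ, mul_comm] at h1; omega
    have h3 : (T : ℝ) ≤ n * B + 2 * B := by exact_mod_cast h2
    linarith
  calc (1 - z) ^ n ≤ (Real.exp (-z)) ^ n :=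
        pow_le_pow_left₀ (by linarith) (Real.one_sub_le_exp_neg z) n
    _ = Real.exp (n * -z) := by rw [← Real.exp_nat_mul]
    _ ≤ Real.exp (4 + -(l + l)) := by
        refine Real.exp_le_exp.2 ?_
        have h1 : 2 * l - 4 ≤ n * z := by
          have e : n * z = 2 * l * (n * B) / T := by rw [hz]; field_simp
          rw [e, le_div_iff₀ hT]
          nlinarith [mul_le_mul_of_nonneg_left hnB hl0]
        linarith
    _ = Real.exp 4 * (B / T) ^ 2 := by
        rw [Real.exp_add, Real.exp_neg, Real.exp_add, hl, Real.exp_log hx]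
        field_simp

/-- Since `log x ≤ 2 √x`, the hypothesis forces `e √x ≤ 4 m` for `x = T / B`. It covers the case of
a step too large to contract. -/
theorem div_le_of_log_large (hB : 1 ≤ B) (hBT : B < T) {m e : ℝ} (he : 0 < e)
    (h : 1 < 2 * (B * Real.log ((T : ℝ) / B) / (e * T)) * m) :
    (T : ℝ) / B ≤ 16 * m ^ 2 / e ^ 2 := by
  have hB' : (1 : ℝ) ≤ B := by exact_mod_cast hB
  have hBT' : (B : ℝ) + 1 ≤ T := by exact_mod_cast hBT
  have hT : (0 : ℝ) < T := by linarith
  have hx : (0 : ℝ) < T / B := by positivity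
  have e1 : 2 * (B * Real.log ((T : ℝ) / B) / (e * T)) * m =
      2 * m * Real.log ((T : ℝ) / B) / (e * (T / B)) := by field_simp
  rw [e1, lt_div_iff₀ (by positivity), one_mul] at h
  set x : ℝ := T / B
  have hx1 : 1 ≤ x := (one_le_div (by linarith)).2 (by linarith)
  have hs : 0 < √x := Real.sqrt_pos.2 hx
  have hsq : √x * √x = x := Real.mul_self_sqrt hx.le
  have hl0 : 0 ≤ Real.log x := Real.log_nonneg hx1
  have hlog : Real.log x ≤ 2 * √x := by
    have h1 := Real.log_le_sub_one_of_pos hs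
    rw [Real.log_sqrt hx.le] at h1
    linarith
  have hm : 0 < m := by
    by_contra hm
    have : 2 * m * Real.log x ≤ 0 := mul_nonpos_of_nonpos_of_nonneg (by linarith) hl0
    have : 0 < e * x := by positivity
    linarith
  have h2 : e * √x ≤ 4 * m := by
    refine le_of_mul_le_mul_right ?_ hs
    have := mul_le_mul_of_nonneg_left hlog (by positivity : 0 ≤ 2 * m)
    calc e * √x * √x = e * x := by rw [mul_assoc, hsq]
      _ ≤ 2 * m * (2 * √x) := h.le.trans this
      _ = 4 * m * √x := by ring
  rw [le_div_iff₀ (by positivity)]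
  calc x * e ^ 2 = (e * √x) ^ 2 := by rw [mul_pow, pow_two √x, hsq, mul_comm]
    _ ≤ (4 * m) ^ 2 := by gcongr
    _ = 16 * m ^ 2 := by ring

end Schedule

/-! ### The convergence rate -/

section Convergence

variable {N d T : ℕ} {R D U Uc δ η : ℝ} {μ r : Fin N → ℝ} {L : Fin N → Fin N → ℝ}
  {X : Fin N → Set (Act d)} {C : Fin N → JointAct N d → ℝ} {S : Fin N → Set ℕ}
  {x₁ xhat₀ : JointAct N d}

/-- The coefficient of `δ + η / δ ^ 2` in the error of one step. -/
noncomputable def stepErrorConst (d : ℕ) (R D U Uc Λ : ℝ) : ℝ :=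
  Λ * D + Λ * (R * (d * Uc)) * D + Λ * (D ^ 2 / R) + U * (D / R) + d * Λ * D + (d * Uc) ^ 2

/-- The asymptotic level of the weighted mean-square error, as a coefficient of
`δ + η / δ ^ 2`. -/
noncomputable def errorLevelConst (d : ℕ) (R D U Uc : ℝ) (μ r : Fin N → ℝ)
    (L : Fin N → Fin N → ℝ) : ℝ :=
  (∑ i, 1 / (quasidominanceGap μ r L * r i ^ 2)) *
    stepErrorConst d R D U Uc (∑ i, ∑ j, L i j)

namespace IsQuasidominantGame

theorem gap_le (i : Fin N) : quasidominanceGap μ r L ≤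
    μ i - 1 / r i * ∑ j ∈ Finset.univ.erase i, r j * L i j :=
  ciInf_le (Set.finite_range _).bddBelow i

theorem gap_pos (h : IsQuasidominantGame R D U Uc μ r L X C) (hN : 0 < N) :
    0 < quasidominanceGap μ r L := by
  have : Nonempty (Fin N) := ⟨⟨0, hN⟩⟩
  obtain ⟨i, hi⟩ := exists_eq_ciInf_of_finite
    (f := fun i : Fin N => μ i - 1 / r i * ∑ j ∈ Finset.univ.erase i, r j * L i j)
  rw [quasidominanceGap, ← hi, sub_pos, one_div_mul_eq_div, div_lt_iff₀ (h.r_pos i)]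
  simpa [mul_comm] using h.quasidominance i

theorem U_nonneg (h : IsQuasidominantGame R D U Uc μ r L X C) (hN : 0 < N) : 0 ≤ U :=
  (norm_nonneg _).trans (h.grad_bound ⟨0, hN⟩ 0 h.zero_mem)

theorem Uc_nonneg (h : IsQuasidominantGame R D U Uc μ r L X C) (hN : 0 < N) : 0 ≤ Uc :=
  (abs_nonneg _).trans (h.cost_bound ⟨0, hN⟩ 0 h.zero_mem)

theorem stepErrorConst_nonneg (h : IsQuasidominantGame R D U Uc μ r L X C) (hN : 0 < N) :
    0 ≤ stepErrorConst d R D U Uc (∑ i, ∑ j, L i j) := by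
  have hR := h.R_pos
  have hD := h.D_pos
  have hU := h.U_nonneg hN
  have hUc := h.Uc_nonneg hN
  have hΛ : 0 ≤ ∑ i, ∑ j, L i j :=
    Finset.sum_nonneg fun i _ => Finset.sum_nonneg fun j _ => h.L_nonneg i j
  unfold stepErrorConst
  positivity

theorem errorLevelConst_nonneg (h : IsQuasidominantGame R D U Uc μ r L X C) (hN : 0 < N) :
    0 ≤ errorLevelConst d R D U Uc μ r L := by
  have := h.gap_pos hN
  exact mul_nonneg (Finset.sum_nonneg fun i _ => by positivity) (h.stepErrorConst_nonneg hN)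

/-- After a factor `2 * η` is taken out, each error is of order `δ` or `κ = η / δ ^ 2`; the delay
term `η / δ = δ * κ` is at most `R * κ`. The sum of `1 / (ε r j ^ 2)` in `errorLevelConst` makes one
level serve all agents. -/
theorem stepError_le (h : IsQuasidominantGame R D U Uc μ r L X C) (hN : 0 < N) (hδ : 0 < δ)
    (hδR : δ < R) (hη : 0 ≤ η) (i : Fin N) :
    2 * η * ((∑ j, L i j) * ((δ + η * (d / δ * Uc)) * D + δ / R * D ^ 2) + U * (δ / R * D) +
      d * L i i * δ * D) + η ^ 2 * (d / δ * Uc) ^ 2 ≤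
    2 * η * (quasidominanceGap μ r L * (errorLevelConst d R D U Uc μ r L * (δ + η / δ ^ 2))) *
      r i ^ 2 := by
  have hR := h.R_pos
  have hD := h.D_pos
  have hU := h.U_nonneg hN
  have hUc := h.Uc_nonneg hN
  have hε := h.gap_pos hN
  have hri := h.r_pos i
  set κ := η / δ ^ 2 with hκ
  have hκ0 : 0 ≤ κ := by positivity
  set Λ := ∑ i, ∑ j, L i j with hΛdef
  have hΛi : ∑ j, L i j ≤ Λ := Finset.single_le_sum (f := fun i => ∑ j, L i j)
    (fun i _ => Finset.sum_nonneg fun j _ => h.L_nonneg i j) (Finset.mem_univ i)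
  have hLii : L i i ≤ Λ := (Finset.single_le_sum (f := fun j => L i j)
    (fun j _ => h.L_nonneg i j) (Finset.mem_univ i)).trans hΛi
  have hΛi0 : 0 ≤ ∑ j, L i j := Finset.sum_nonneg fun j _ => h.L_nonneg i j
  have hΛ0 : 0 ≤ Λ := hΛi0.trans hΛi
  have hηδ : η * (d / δ * Uc) ≤ R * (d * Uc) * κ := by
    have e : η * (d / δ * Uc) = δ * (d * Uc) * κ := by rw [hκ]; field_simp
    rw [e]; gcongr
  have hηG : η ^ 2 * (d / δ * Uc) ^ 2 = 2 * η * (κ * (d * Uc) ^ 2 / 2) := by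
    rw [hκ]; field_simp
  have hmain : (∑ j, L i j) * ((δ + η * (d / δ * Uc)) * D + δ / R * D ^ 2) + U * (δ / R * D) +
      d * L i i * δ * D + κ * (d * Uc) ^ 2 / 2 ≤ stepErrorConst d R D U Uc Λ * (δ + κ) := by
    calc _ ≤ Λ * ((δ + R * (d * Uc) * κ) * D + δ / R * D ^ 2) + U * (δ / R * D) +
        d * Λ * δ * D + κ * (d * Uc) ^ 2 := by
          have : κ * (d * Uc) ^ 2 / 2 ≤ κ * (d * Uc) ^ 2 := half_le_self (by positivity)
          gcongr
      _ = (Λ * D + Λ * (D ^ 2 / R) + U * (D / R) + d * Λ * D) * δ +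
          (Λ * (R * (d * Uc)) * D + (d * Uc) ^ 2) * κ := by ring
      _ ≤ stepErrorConst d R D U Uc Λ * δ + stepErrorConst d R D U Uc Λ * κ := by
          refine add_le_add (mul_le_mul_of_nonneg_right ?_ hδ.le)
            (mul_le_mul_of_nonneg_right ?_ hκ0)
          · have : 0 ≤ Λ * (R * (d * Uc)) * D + (d * Uc) ^ 2 := by positivity
            unfold stepErrorConst; linarith
          · have : 0 ≤ Λ * D + Λ * (D ^ 2 / R) + U * (D / R) + d * Λ * D := by positivity
            unfold stepErrorConst; linarith
      _ = _ := by ring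
  have hsum : 1 ≤ (∑ j, 1 / (quasidominanceGap μ r L * r j ^ 2)) *
      (quasidominanceGap μ r L * r i ^ 2) := by
    have h1 : 1 / (quasidominanceGap μ r L * r i ^ 2) ≤
        ∑ j, 1 / (quasidominanceGap μ r L * r j ^ 2) :=
      Finset.single_le_sum (f := fun j => 1 / (quasidominanceGap μ r L * r j ^ 2))
        (fun j _ => by positivity) (Finset.mem_univ i)
    rwa [div_le_iff₀ (by positivity)] at h1
  have hstep0 := h.stepErrorConst_nonneg hN
  have hlevel : stepErrorConst d R D U Uc Λ * (δ + κ) ≤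
      quasidominanceGap μ r L * (errorLevelConst d R D U Uc μ r L * (δ + κ)) * r i ^ 2 := by
    calc _ ≤ ((∑ j, 1 / (quasidominanceGap μ r L * r j ^ 2)) *
          (quasidominanceGap μ r L * r i ^ 2)) * (stepErrorConst d R D U Uc Λ * (δ + κ)) :=
          le_mul_of_one_le_left (by positivity) hsum
      _ = _ := by unfold errorLevelConst; ring
  rw [hηG, ← mul_add, mul_assoc (2 * η)]
  exact mul_le_mul_of_nonneg_left (hmain.trans hlevel) (by positivity)

/-- Contraction of the weighted maximal mean-square error towards its asymptotic level. -/
theorem weighted_step_le (h : IsQuasidominantGame R D U Uc μ r L X C) (hN : 0 < N)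
    {i : Fin N} {c A E V' : ℝ} {V : Fin N → ℝ} (hη : 0 ≤ η) (hημ : 2 * η * μ i ≤ 1)
    (hc : 0 ≤ c) (hA : 0 ≤ A) (hV : ∀ j, V j / r j ^ 2 ≤ c + A)
    (hE : E ≤ 2 * η * (quasidominanceGap μ r L * c) * r i ^ 2)
    (hstep : V' ≤ V i - 2 * η * (μ i * V i - ∑ j ∈ Finset.univ.erase i,
      L i j * (r i * r j / 2 * (V j / r j ^ 2 + V i / r i ^ 2))) + E) :
    V' / r i ^ 2 ≤ c + (1 - 2 * η * quasidominanceGap μ r L) * A := by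
  have hri := h.r_pos i
  have hgap := gap_le (μ := μ) (r := r) (L := L) i
  have hε := h.gap_pos hN
  set ε := quasidominanceGap μ r L
  set s := ∑ j ∈ Finset.univ.erase i, r j * L i j with hs
  have hs0 : 0 ≤ s := Finset.sum_nonneg fun j _ => mul_nonneg (h.r_pos j).le (h.L_nonneg i j)
  set M := c + A with hM
  set y := V i / r i ^ 2 with hy
  have hVi : V i = r i ^ 2 * y := by rw [hy]; field_simp
  have hsum : ∑ j ∈ Finset.univ.erase i, L i j * (r i * r j / 2 * (V j / r j ^ 2 + y)) ≤
      r i / 2 * (M + y) * s := by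
    rw [hs, Finset.mul_sum]
    refine Finset.sum_le_sum fun j _ => ?_
    have h1 : L i j * (r i * r j / 2 * (V j / r j ^ 2 + y)) ≤
        L i j * (r i * r j / 2 * (M + y)) := by
      have := h.L_nonneg i j
      have := h.r_pos j
      have := hV j
      gcongr
    exact h1.trans_eq (by ring)
  have hyM : y ≤ M := hV i
  set p := 1 / r i * s with hp
  have hp0 : 0 ≤ p := by positivity
  have hrs : s = r i * p := by rw [hp]; field_simp
  rw [div_le_iff₀ (by positivity)]
  rw [hVi] at hstep
  rw [hrs] at hsum
  have h2 : V' ≤ r i ^ 2 * (y * (1 - 2 * η * μ i + η * p) + η * p * M + 2 * η * (ε * c)) := by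
    have := mul_le_mul_of_nonneg_left hsum (by positivity : 0 ≤ 2 * η)
    linarith
  -- The condition `2 * η * μ i ≤ 1` makes this coefficient nonnegative, so `y` may be replaced by
  -- its upper bound `M`. The total factor of `M` becomes `1 - 2 * η * (μ i - p)`, and `μ i - p` is
  -- at least the gap.
  have h3 : y * (1 - 2 * η * μ i + η * p) ≤ M * (1 - 2 * η * μ i + η * p) :=
    mul_le_mul_of_nonneg_right hyM (by have := mul_nonneg hη hp0; linarith)
  have h4 : M * (2 * η * ε) ≤ M * (2 * η * (μ i - p)) := by gcongr
  have h5 : y * (1 - 2 * η * μ i + η * p) + η * p * M + 2 * η * (ε * c) ≤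
      c + (1 - 2 * η * ε) * A := by
    rw [hM] at *
    linarith
  rw [mul_comm _ (r i ^ 2)]
  exact h2.trans (mul_le_mul_of_nonneg_left h5 (by positivity))

/-- Mean-square distance to the shrunk equilibrium under the product of uniform measures. -/
theorem integral_pi_sqDist_le (h : IsQuasidominantGame R D U Uc μ r L X C) (hN : 0 < N)
    (hd : 0 < d) (hδ : 0 < δ) (hδR : δ < R) (hη : 0 ≤ η) (hημ : ∀ i, 2 * η * μ i ≤ 1)
    {B : ℕ} (hBT : B < T) (hS : PartiallyAsynchronous S B)
    (hx₁ : ∀ i, x₁ i ∈ shrunk R δ (X i)) (hxhat₀ : xhat₀ ∈ jointSet X)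
    (s₀ : Metric.sphere (0 : Act d) 1) {xs : JointAct N d} (hxs : IsNash X C xs)
    [Fintype (ActivePair S T)] (i : Fin N) :
    ∫ w, ‖(zoState R δ η X C S x₁ xhat₀ (extendSample s₀ w) (T - 1)).1 i -
      (1 - δ / R) • xs i‖ ^ 2 ∂(Measure.pi fun _ : ActivePair S T => uniformSphere d) ≤
    r i ^ 2 * (errorLevelConst d R D U Uc μ r L * (δ + η / δ ^ 2) +
      (1 - 2 * η * quasidominanceGap μ r L) ^ ((T - 1 - B) / B) * ∑ j, D ^ 2 / r j ^ 2) := by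
  have := isProbabilityMeasure_uniformSphere hd
  set ν := Measure.pi fun _ : ActivePair S T => uniformSphere d with hν
  set V : Fin N → ℕ → ℝ := fun j l => ∫ w, ‖(zoState R δ η X C S x₁ xhat₀
      (extendSample s₀ w) l).1 j - (1 - δ / R) • xs j‖ ^ 2 ∂ν with hV
  set c := errorLevelConst d R D U Uc μ r L * (δ + η / δ ^ 2) with hc
  have hε := h.gap_pos hN
  have hc0 : 0 ≤ c := mul_nonneg (h.errorLevelConst_nonneg hN) (by positivity)
  have hq1 : 1 - 2 * η * quasidominanceGap μ r L ≤ 1 := by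
    have : 0 ≤ 2 * η * quasidominanceGap μ r L := by positivity
    linarith
  have hq0 : 0 ≤ 1 - 2 * η * quasidominanceGap μ r L := by
    have h1 := gap_le (μ := μ) (r := r) (L := L) i
    have h2 : 0 ≤ 1 / r i * ∑ j ∈ Finset.univ.erase i, r j * L i j :=
      mul_nonneg (one_div_nonneg.2 (h.r_pos i).le)
        (Finset.sum_nonneg fun j _ => mul_nonneg (h.r_pos j).le (h.L_nonneg i j))
    have h3 : 2 * η * quasidominanceGap μ r L ≤ 2 * η * μ i := by
      refine mul_le_mul_of_nonneg_left ?_ (by positivity)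
      linarith
    have := hημ i
    linarith
  have hact : ∀ k, B ≤ k → ∀ j, ∃ t ∈ S j, 1 ≤ t ∧ t ≤ k := by
    intro k hk j
    obtain ⟨t, ht, h1, h2⟩ := hS j 1 le_rfl
    exact ⟨t, ht, h1, by omega⟩
  -- The recursion starts at `B`, when all agents have acted and the arbitrary `xhat₀` is forgotten;
  -- before that only the diameter bound is used. It ends at `T - 1`, the index of `x_T`.
  have hrec := window_contraction (Y := fun j l => V j l / r j ^ 2) (k₀ := B) (K := T - 1)
    (c := c) (q := 1 - 2 * η * quasidominanceGap μ r L) (A := ∑ j, D ^ 2 / r j ^ 2) hS hq0 hq1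
    (fun k i hi => by simp only [hV, zoState_succ_fst_of_notMem _ hi])
    (fun k hk hkT i hi A hA hY => by
      have hstep := h.integral_step_le (T := T) hd hδ hδR hη hx₁ hxhat₀ s₀ (by omega) (hact k hk) hi
        hxs hV
      refine h.weighted_step_le hN (V := fun j => V j k) hη (hημ i) hc0 hA hY
        (h.stepError_le hN hδ hδR hη i) ?_
      linarith)
    (Finset.sum_nonneg fun j _ => by positivity)
    (fun j => by
      have hy := (smul_mem_shrunk (h.convex j) (h.zero_mem j) h.R_pos hδ hδR (hxs.1 j)).1
      have h1 : V j B ≤ D ^ 2 := by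
        have := integral_mono (h.integrable_sqDist (η := η) hδ hδR hx₁ hxhat₀ s₀ B hy ν)
          (integrable_const (D ^ 2)) fun w => h.sqDist_le hδ hδR hx₁ hxhat₀ _ B hy
        simpa using this
      have h2 : D ^ 2 / r j ^ 2 ≤ ∑ j, D ^ 2 / r j ^ 2 :=
        Finset.single_le_sum (f := fun j => D ^ 2 / r j ^ 2) (fun j _ => by positivity)
          (Finset.mem_univ j)
      have h3 : V j B / r j ^ 2 ≤ D ^ 2 / r j ^ 2 := by gcongr
      linarith)
    ((T - 1 - B) / B) (T - 1)
    (by have := Nat.div_mul_le_self (T - 1 - B) B; omega) le_rfl i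
  have hri := h.r_pos i
  rwa [div_le_iff₀ (by positivity), mul_comm] at hrec

end IsQuasidominantGame

/-- The constant in the rate of convergence to the Nash equilibrium. -/
noncomputable def rateConst (d : ℕ) (R D U Uc : ℝ) (μ r : Fin N → ℝ)
    (L : Fin N → Fin N → ℝ) : ℝ :=
  2 * ((∑ i, r i ^ 2) * (errorLevelConst d R D U Uc μ r L * (2 + 1 / quasidominanceGap μ r L) +
    Real.exp 4 * 2 * ∑ j, D ^ 2 / r j ^ 2)) + 4 * D ^ 2 / R +
  2 * (∑ i, 16 * μ i ^ 2 / quasidominanceGap μ r L ^ 2) * D ^ 2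

-- Each contribution is bounded by a multiple of the rate `Z`. Either the step size permits
-- contraction for all agents, or the horizon is so short that `D ^ 2` is already of order `Z`.
set_option maxHeartbeats 800000 in
theorem IsQuasidominantGame.integral_pi_sqDist_nash_le
    (h : IsQuasidominantGame R D U Uc μ r L X C) (hN : 0 < N)
    (hd : 0 < d) {B : ℕ} (hB : 1 ≤ B) (hBT : B < T)
    (hδB : δ = (B : ℝ) / (T : ℝ) ^ (1 / 3 : ℝ)) (hδR : δ < R)
    (hηB : η = (B : ℝ) * Real.log ((T : ℝ) / B) / (quasidominanceGap μ r L * T))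
    (hS : PartiallyAsynchronous S B)
    (hx₁ : ∀ i, x₁ i ∈ shrunk R δ (X i)) (hxhat₀ : xhat₀ ∈ jointSet X)
    (s₀ : Metric.sphere (0 : Act d) 1) {xs : JointAct N d} (hxs : IsNash X C xs)
    [Fintype (ActivePair S T)] (i : Fin N) :
    ∫ w, ‖(zoState R δ η X C S x₁ xhat₀ (extendSample s₀ w) (T - 1)).1 i - xs i‖ ^ 2
      ∂(Measure.pi fun _ : ActivePair S T => uniformSphere d) ≤
    rateConst d R D U Uc μ r L *
      ((B : ℝ) ^ 2 * Real.log ((T : ℝ) / B) / (T : ℝ) ^ (1 / 3 : ℝ)) := by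
  have := isProbabilityMeasure_uniformSphere hd
  have hR := h.R_pos
  have hD := h.D_pos
  have hε := h.gap_pos hN
  have hlevel := h.errorLevelConst_nonneg hN
  have hB' : (1 : ℝ) ≤ B := by exact_mod_cast hB
  have hBT' : (B : ℝ) + 1 ≤ T := by exact_mod_cast hBT
  have hT1 : (1 : ℝ) ≤ T := by linarith
  have hT : (0 : ℝ) < T := by linarith
  have hBl := half_le_mul_log hB hBT
  set ν := Measure.pi fun _ : ActivePair S T => uniformSphere d with hν
  set ε := quasidominanceGap μ r L with hεdef
  set l := Real.log ((T : ℝ) / B) with hl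
  set q := (T : ℝ) ^ (1 / 3 : ℝ) with hq
  have hl0 : 0 ≤ l := Real.log_nonneg ((one_le_div (by linarith)).2 (by linarith))
  have hq1 : 1 ≤ q := Real.one_le_rpow hT1 (by norm_num)
  have hq0 : 0 < q := by linarith
  have hq3 : q ^ 3 = T := by
    rw [hq, ← Real.rpow_natCast, ← Real.rpow_mul hT.le]; norm_num
  have hqT : q ≤ T := by rw [← hq3]; exact le_self_pow₀ hq1 (by norm_num)
  set Z := (B : ℝ) ^ 2 * l / q with hZ
  have hZ0 : 0 ≤ Z := by positivity
  have hδ : 0 < δ := by rw [hδB]; positivity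
  have hη : 0 ≤ η := by rw [hηB]; positivity
  have hδZ : δ ≤ 2 * Z := by
    rw [hδB, hZ, ← mul_div_assoc]
    refine div_le_div_of_nonneg_right ?_ hq0.le
    nlinarith
  have hBTδ : (B : ℝ) / T ≤ δ := by rw [hδB]; gcongr
  have hmain0 : 0 ≤ 2 * ((∑ i, r i ^ 2) * (errorLevelConst d R D U Uc μ r L * (2 + 1 / ε) +
      Real.exp 4 * 2 * ∑ j, D ^ 2 / r j ^ 2)) + 4 * D ^ 2 / R := by
    have h1 : 0 ≤ ∑ i, r i ^ 2 := Finset.sum_nonneg fun i _ => by positivity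
    have h2 : 0 ≤ ∑ j, D ^ 2 / r j ^ 2 := Finset.sum_nonneg fun i _ => by positivity
    positivity
  have htriv0 : 0 ≤ 2 * (∑ i, 16 * μ i ^ 2 / ε ^ 2) * D ^ 2 := by
    have h1 : 0 ≤ ∑ i, 16 * μ i ^ 2 / ε ^ 2 := Finset.sum_nonneg fun i _ => by positivity
    positivity
  have hint := h.integrable_sqDist (S := S) (T := T) (η := η) hδ hδR hx₁ hxhat₀ s₀ (T - 1)
    (hxs.1 i) ν
  unfold rateConst
  rw [← hεdef, add_mul]
  by_cases hsmall : ∀ i, 2 * η * μ i ≤ 1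
  · refine le_add_of_le_of_nonneg ?_ (mul_nonneg htriv0 hZ0)
    have hV := h.integral_pi_sqDist_le hN hd hδ hδR hη hsmall hBT hS hx₁ hxhat₀ s₀ hxs i
    set y := (1 - δ / R) • xs i with hy
    have hyX := (smul_mem_shrunk (h.convex i) (h.zero_mem i) hR hδ hδR (hxs.1 i)).1
    have hint' := h.integrable_sqDist (S := S) (T := T) (η := η) hδ hδR hx₁ hxhat₀ s₀ (T - 1)
      hyX ν
    -- The squared shrinkage factor is bounded by its first power, which is enough at order `δ`.
    have hshift : ‖y - xs i‖ ^ 2 ≤ δ * (D ^ 2 / R) := by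
      have e : y - xs i = -((δ / R) • xs i) := by rw [hy]; module
      have hτ1 : δ / R ≤ 1 := (div_le_one hR).2 hδR.le
      have hτ0 : 0 ≤ δ / R := by positivity
      rw [e, norm_neg, norm_smul, Real.norm_of_nonneg hτ0, mul_pow]
      calc (δ / R) ^ 2 * ‖xs i‖ ^ 2 ≤ (δ / R) * D ^ 2 := by
            have := h.norm_le (hxs.1 i)
            have : (δ / R) ^ 2 ≤ δ / R := by nlinarith
            gcongr
        _ = _ := by ring
    have hmono : ∫ w, ‖(zoState R δ η X C S x₁ xhat₀ (extendSample s₀ w) (T - 1)).1 i -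
        xs i‖ ^ 2 ∂ν ≤ ∫ w, (2 * ‖(zoState R δ η X C S x₁ xhat₀ (extendSample s₀ w)
          (T - 1)).1 i - y‖ ^ 2 + 2 * (δ * (D ^ 2 / R))) ∂ν := by
      refine integral_mono hint ((hint'.const_mul 2).add (integrable_const _)) fun w => ?_
      change ‖(zoState R δ η X C S x₁ xhat₀ (extendSample s₀ w) (T - 1)).1 i - xs i‖ ^ 2 ≤
        2 * ‖(zoState R δ η X C S x₁ xhat₀ (extendSample s₀ w) (T - 1)).1 i - y‖ ^ 2 +
          2 * (δ * (D ^ 2 / R))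
      have h1 := norm_sub_le_norm_sub_add_norm_sub
        ((zoState R δ η X C S x₁ xhat₀ (extendSample s₀ w) (T - 1)).1 i) y (xs i)
      have h2 := pow_le_pow_left₀ (norm_nonneg _) h1 2
      have h3 := sq_nonneg (‖(zoState R δ η X C S x₁ xhat₀ (extendSample s₀ w) (T - 1)).1 i - y‖ -
        ‖y - xs i‖)
      linarith
    rw [integral_add (hint'.const_mul 2) (integrable_const _), integral_const_mul] at hmono
    simp only [integral_const, probReal_univ, one_smul] at hmono
    -- With `q ^ 3 = T`, the quotient equals `l / (ε * B * q)`, smaller than `Z / ε` by the factor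
    -- `B ^ 3`.
    have hκ : η / δ ^ 2 ≤ 1 / ε * Z := by
      have e : η / δ ^ 2 = 1 / ε * (l / (B * q)) := by
        rw [hηB, hδB, ← hq3]; field_simp
      rw [e, hZ]
      refine mul_le_mul_of_nonneg_left ?_ (by positivity)
      rw [div_le_div_iff₀ (by positivity) hq0]
      have : l * q * 1 ≤ l * q * B ^ 3 :=
        mul_le_mul_of_nonneg_left (one_le_pow₀ hB') (by positivity)
      linarith
    have hz : 2 * η * ε = 2 * (B * l / T) := by rw [hηB]; field_simp
    -- Uses `(B / T) ^ 2 ≤ B / T ≤ δ ≤ 2 * Z`.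
    have hpow : (1 - 2 * η * ε) ^ ((T - 1 - B) / B) ≤ Real.exp 4 * 2 * Z := by
      refine (one_sub_pow_le_of_schedule hB hBT ?_ hz).trans ?_
      · have h1 := IsQuasidominantGame.gap_le (μ := μ) (r := r) (L := L) i
        have h2 : 0 ≤ 1 / r i * ∑ j ∈ Finset.univ.erase i, r j * L i j :=
          mul_nonneg (one_div_nonneg.2 (h.r_pos i).le)
            (Finset.sum_nonneg fun j _ => mul_nonneg (h.r_pos j).le (h.L_nonneg i j))
        exact (mul_le_mul_of_nonneg_left (by linarith : ε ≤ μ i) (by positivity)).trans (hsmall i)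
      · rw [mul_assoc]
        refine mul_le_mul_of_nonneg_left ?_ (Real.exp_pos _).le
        have h1 : (B : ℝ) / T ≤ 1 := (div_le_one hT).2 (by linarith)
        have h2 : (0 : ℝ) ≤ B / T := by positivity
        nlinarith
    have hA0 : 0 ≤ ∑ j, D ^ 2 / r j ^ 2 := Finset.sum_nonneg fun i _ => by positivity
    have hbr : errorLevelConst d R D U Uc μ r L * (δ + η / δ ^ 2) +
        (1 - 2 * η * ε) ^ ((T - 1 - B) / B) * ∑ j, D ^ 2 / r j ^ 2 ≤
        (errorLevelConst d R D U Uc μ r L * (2 + 1 / ε) +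
          Real.exp 4 * 2 * ∑ j, D ^ 2 / r j ^ 2) * Z := by
      have h1 := mul_le_mul_of_nonneg_left (add_le_add hδZ hκ) hlevel
      have h2 := mul_le_mul_of_nonneg_right hpow hA0
      linarith
    have hbr0 : 0 ≤ (errorLevelConst d R D U Uc μ r L * (2 + 1 / ε) +
        Real.exp 4 * 2 * ∑ j, D ^ 2 / r j ^ 2) * Z := by positivity
    have hri : r i ^ 2 ≤ ∑ i, r i ^ 2 := Finset.single_le_sum (f := fun i => r i ^ 2)
      (fun i _ => by positivity) (Finset.mem_univ i)
    have hV2 := hV.trans ((mul_le_mul_of_nonneg_left hbr (by positivity)).trans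
      (mul_le_mul_of_nonneg_right hri hbr0))
    have hsh := mul_le_mul_of_nonneg_right hδZ (by positivity : 0 ≤ D ^ 2 / R)
    have e : (4 * D ^ 2 / R) * Z = 2 * (2 * Z * (D ^ 2 / R)) := by ring
    rw [add_mul, e]
    linarith
  · refine le_add_of_nonneg_of_le (mul_nonneg hmain0 hZ0) ?_
    push Not at hsmall
    obtain ⟨m, hm⟩ := hsmall
    rw [hηB] at hm
    have h1 := div_le_of_log_large hB hBT hε hm
    have h2 : 16 * μ m ^ 2 / ε ^ 2 ≤ ∑ i, 16 * μ i ^ 2 / ε ^ 2 :=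
      Finset.single_le_sum (f := fun i => 16 * μ i ^ 2 / ε ^ 2) (fun i _ => by positivity)
        (Finset.mem_univ m)
    have h3 : (1 : ℝ) / 2 * (B / T) ≤ Z := by linarith
    have h4 : ∫ w, ‖(zoState R δ η X C S x₁ xhat₀ (extendSample s₀ w) (T - 1)).1 i -
        xs i‖ ^ 2 ∂ν ≤ D ^ 2 := by
      have := integral_mono hint (integrable_const (D ^ 2)) fun w =>
        h.sqDist_le hδ hδR hx₁ hxhat₀ _ (T - 1) (hxs.1 i)
      simpa using this
    refine h4.trans ?_
    -- A large step bounds `T / B` by the sum, while `Z ≥ B / (2 T)`; the product of the two bounds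
    -- is scale free.
    have h5 : (1 : ℝ) / 2 ≤ (∑ i, 16 * μ i ^ 2 / ε ^ 2) * Z := by
      calc (1 : ℝ) / 2 = (T / B) * (1 / 2 * (B / T)) := by field_simp
        _ ≤ _ := mul_le_mul (h1.trans h2) h3 (by positivity)
          ((by positivity : (0 : ℝ) ≤ T / B).trans (h1.trans h2))
    have h6 := mul_le_mul_of_nonneg_right h5 (sq_nonneg D)
    generalize ∑ i, 16 * μ i ^ 2 / ε ^ 2 = w at h6 ⊢
    calc D ^ 2 = 2 * (1 / 2 * D ^ 2) := by ring
      _ ≤ 2 * (w * Z * D ^ 2) := mul_le_mul_of_nonneg_left h6 zero_le_two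
      _ = 2 * w * D ^ 2 * Z := by ring

end Convergence

/-- The iterate is a function of the finitely many sampled directions, whose joint law is the
product of uniform laws. The expectation over `Ω` is thus the product integral already bounded. -/
theorem theorem2 (N d : ℕ) (hN : 0 < N) (hd : 0 < d) (R D U Uc : ℝ)
    (μ r : Fin N → ℝ) (L : Fin N → Fin N → ℝ) :
    ∃ K : ℝ, ∀ (X : Fin N → Set (Act d)) (C : Fin N → JointAct N d → ℝ),
      IsQuasidominantGame R D U Uc μ r L X C →
      (∃! xs : JointAct N d, IsNash X C xs) ∧
      ∀ xs : JointAct N d, IsNash X C xs →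
      ∀ (B T : ℕ) (δ η : ℝ), 1 ≤ B → B < T →
        δ = (B : ℝ) / (T : ℝ) ^ (1 / 3 : ℝ) → δ < R →
        η = (B : ℝ) * Real.log ((T : ℝ) / B) / (quasidominanceGap μ r L * T) →
      ∀ S : Fin N → Set ℕ, PartiallyAsynchronous S B →
      ∀ x₁ xhat₀ : JointAct N d, (∀ i, x₁ i ∈ shrunk R δ (X i)) → xhat₀ ∈ jointSet X →
      ∀ {Ω : Type*} [MeasurableSpace Ω] (P : Measure Ω) [IsProbabilityMeasure P]
        (u : Fin N → ℕ → Ω → Metric.sphere (0 : Act d) 1), IsUniformSampling P S T u →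
        (∀ i, Integrable (fun ω =>
          ‖zoIterate R δ η X C S x₁ xhat₀ (fun i t => u i t ω) T i - xs i‖ ^ 2) P) ∧
        (⨆ i : Fin N, ∫ ω,
          ‖zoIterate R δ η X C S x₁ xhat₀ (fun i t => u i t ω) T i - xs i‖ ^ 2 ∂P)
          ≤ K * ((B : ℝ) ^ 2 * Real.log ((T : ℝ) / B) / (T : ℝ) ^ (1 / 3 : ℝ)) := by
  refine ⟨rateConst d R D U Uc μ r L, fun X C h => ⟨h.existsUnique_isNash, ?_⟩⟩
  intro xs hxs B T δ η hB hBT hδB hδR hηB S hS x₁ xhat₀ hx₁ hxhat₀ Ω _ P _ u hu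
  have : Nonempty (Fin N) := ⟨⟨0, hN⟩⟩
  have : Nonempty (Fin d) := ⟨⟨0, hd⟩⟩
  have : Fintype (ActivePair S T) := Fintype.ofFinite _
  have := isProbabilityMeasure_uniformSphere hd
  obtain ⟨v₀, hv₀⟩ := NormedSpace.sphere_nonempty (E := Act d) (x := 0) (r := 1) |>.2 zero_le_one
  let s₀ : Metric.sphere (0 : Act d) 1 := ⟨v₀, hv₀⟩
  have hδ : 0 < δ := by
    have : (0 : ℝ) < B := by exact_mod_cast hB
    have : (0 : ℝ) < T := by exact_mod_cast (by omega : 0 < T)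
    rw [hδB]; positivity
  let W : Ω → ActivePair S T → Metric.sphere (0 : Act d) 1 := fun ω p => u p.1.1 p.1.2 ω
  have hW : Measurable W := measurable_pi_lambda _ fun p => hu.measurable p
  let F : Fin N → (ActivePair S T → Metric.sphere (0 : Act d) 1) → ℝ := fun i w =>
    ‖(zoState R δ η X C S x₁ xhat₀ (extendSample s₀ w) (T - 1)).1 i - xs i‖ ^ 2
  have heq : ∀ i ω, ‖zoIterate R δ η X C S x₁ xhat₀ (fun i t => u i t ω) T i - xs i‖ ^ 2 =
      F i (W ω) := by
    intro i ω
    -- Directions at idle times never enter the state, so filling them with `s₀` changes nothing.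
    have : zoState R δ η X C S x₁ xhat₀ (fun i t => u i t ω) (T - 1) =
        zoState R δ η X C S x₁ xhat₀ (extendSample s₀ (W ω)) (T - 1) :=
      zoState_congr fun j t ht h1 h2 => by
        rw [extendSample_of_active s₀ (W ω) ⟨ht, h1, by omega⟩]
    simp only [zoIterate, this, F]
  have hFm : ∀ i, Measurable (F i) := fun i =>
    h.measurable_sqDist hδ hδR hx₁ hxhat₀ s₀ (T - 1) i (xs i)
  simp only [heq]
  have hFint : ∀ i, Integrable (F i) (Measure.pi fun _ : ActivePair S T => uniformSphere d) :=
    fun i => h.integrable_sqDist hδ hδR hx₁ hxhat₀ s₀ (T - 1) (hxs.1 i) _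
  have hmap : P.map W = Measure.pi fun _ : ActivePair S T => uniformSphere d := hu.map_eq_pi
  refine ⟨fun i => ?_, ciSup_le fun i => ?_⟩
  · have := hFint i
    rw [← hmap] at this
    exact this.comp_measurable hW
  · rw [← integral_map hW.aemeasurable (hFm i).aestronglyMeasurable, hmap]
    exact h.integral_pi_sqDist_nash_le hN hd hB hBT hδB hδR hηB hS hx₁ hxhat₀ s₀ hxs i
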